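/- Let $(\mathbb X,\mathcal X)$ be a measurable space with a $\sigma$-finite measure $\lambda$, let $\mathbf N$ be the space of integer-valued (with values in $\{0,1,2,\dots\}\cup\{\infty\}$) $\sigma$-finite measures on $\mathbb X$, equipped with the smallest $\sigma$-field making all the maps $\mu\mapsto\mu(B)$, $B\in\mathcal X$, measurable, and let $\eta$ be a Poisson process on $\mathbb X$ with intensity measure $\lambda$, that is, a random element of $\mathbf N$, defined on a probability space $(\Omega,\mathcal F,\mathbb P)$, such that $\eta(B)$ is Poisson distributed with parameter $\lambda(B)$ for every $B\in\mathcal X$ and $\eta(B_1),\dots,\eta(B_n)$ are independent for pairwise disjoint $B_1,\dots,B_n\in\mathcal X$. Let $F\in L^2(\mathbb P)$ satisfy $F=f(\eta)$ $\mathbb P$-a.s. for a measurable function $f:\mathbf N\to\mathbb R$. Assume that there are an integer $k\ge 1$, sets $I_1,I_2\subset\{1,\dots,k\}$ with $I_1\cup I_2=\{1,\dots,k\}$, a measurable set $U\subset\mathbb X^k$ and $c>0$ such that $$\Big|\mathbb E\Big[f\Big(\eta+\sum_{i\in I_1}\delta_{x_i}\Big)-f\Big(\eta+\sum_{i\in I_2}\delta_{x_i}\Big)\Big]\Big|\ge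 c\qquad\text{for }\lambda^k\text{-a.e. }(x_1,\dots,x_k)\in U.$$ Then $$\operatorname{Var}F\ \ge\ \frac{c^2}{4^{k+1}\,k!}\ \min_{\emptyset\ne J\subset\{1,\dots,k\}}\ \inf_{\substack{V\subset U\text{ measurable}\\ \lambda^k(V)\ge\lambda^k(U)/2^{k+1}}}\ \lambda^{|J|}(\Pi_J(V)),$$ where $\Pi_J$ is the projection onto the components whose indices belong to $J$, and where, if $\Pi_J(V)$ is not measurable, $\lambda^{|J|}(\Pi_J(V))$ denotes its outer measure. -/

import Mathlib

open MeasureTheory ProbabilityTheory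
open scoped ENNReal Nat

noncomputable section

/-- A measure is integer-valued if it takes values in `{0, 1, 2, …} ∪ {∞}`. -/
def IsIntegerValued {X : Type*} [MeasurableSpace X] (μ : Measure X) : Prop :=
  ∀ B : Set X, MeasurableSet B → ∃ n : ℕ∞, μ B = (n : ℝ≥0∞)

/-- The space of integer-valued σ-finite measures on `X`. -/
def Configuration (X : Type*) [MeasurableSpace X] : Type _ :=
  {μ : Measure X // SigmaFinite μ ∧ IsIntegerValued μ}

/-- The trace of the σ-field on `Measure X`, that is, the smallest σ-field making all the
evaluations `μ ↦ μ B`, with `B` measurable, measurable. -/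
instance {X : Type*} [MeasurableSpace X] : MeasurableSpace (Configuration X) :=
  inferInstanceAs (MeasurableSpace {μ : Measure X // SigmaFinite μ ∧ IsIntegerValued μ})

/-- The measure `μ + ∑_{i ∈ I} δ_{x_i}`. -/
def addDiracMeasure {X ι : Type*} [MeasurableSpace X] (μ : Measure X) (I : Finset ι)
    (x : ι → X) : Measure X :=
  μ + ∑ i ∈ I, Measure.dirac (x i)

theorem sigmaFinite_addDiracMeasure {X ι : Type*} [MeasurableSpace X] (μ : Measure X)
    [SigmaFinite μ] (I : Finset ι) (x : ι → X) : SigmaFinite (addDiracMeasure μ I x) := by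
  unfold addDiracMeasure
  infer_instance

theorem isIntegerValued_addDiracMeasure {X ι : Type*} [MeasurableSpace X] {μ : Measure X}
    (hμ : IsIntegerValued μ) (I : Finset ι) (x : ι → X) :
    IsIntegerValued (addDiracMeasure μ I x) := by
  classical
  intro B hB
  unfold addDiracMeasure
  induction I using Finset.induction_on with
  | empty => simpa using hμ B hB
  | insert a s ha ih =>
    obtain ⟨n, hn⟩ := ih
    have h : (μ + ∑ i ∈ insert a s, Measure.dirac (x i)) B
        = Measure.dirac (x a) B + (μ + ∑ i ∈ s, Measure.dirac (x i)) B := by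
      rw [Finset.sum_insert ha]
      simp only [Measure.add_apply]
      ring
    rw [h, hn, Measure.dirac_apply' _ hB]
    by_cases hx : x a ∈ B
    · exact ⟨1 + n, by simp [hx]⟩
    · exact ⟨n, by simp [hx]⟩

/-- The configuration `μ + ∑_{i ∈ I} δ_{x_i}`. -/
def Configuration.addPoints {X ι : Type*} [MeasurableSpace X] (μ : Configuration X)
    (I : Finset ι) (x : ι → X) : Configuration X :=
  ⟨addDiracMeasure μ.1 I x,
    haveI := μ.2.1
    ⟨sigmaFinite_addDiracMeasure μ.1 I x, isIntegerValued_addDiracMeasure μ.2.2 I x⟩⟩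

/-- The Poisson distribution with parameter `a ∈ [0, ∞]`, as a measure on `[0, ∞]`; for `a = ∞`
it is the unit mass at `∞`. -/
def poissonLaw (a : ℝ≥0∞) : Measure ℝ≥0∞ :=
  if a = ∞ then Measure.dirac ∞
  else (poissonMeasure a.toNNReal).map (fun n : ℕ => (n : ℝ≥0∞))

/-- `η` is a Poisson process on `X` with intensity measure `ν`, defined on `(Ω, P)`: a random
element of `Configuration X` such that `η(B)` is Poisson distributed with parameter `ν(B)` for
every measurable `B`, and `η(B₁), …, η(Bₙ)` are independent for all finite families of pairwise
disjoint measurable sets. -/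
structure IsPoissonProcess {X Ω : Type*} [MeasurableSpace X] [MeasurableSpace Ω]
    (η : Ω → Configuration X) (ν : Measure X) (P : Measure Ω) : Prop where
  measurable : Measurable η
  law : ∀ B : Set X, MeasurableSet B → P.map (fun ω => (η ω).1 B) = poissonLaw (ν B)
  indep : ∀ (n : ℕ) (B : Fin n → Set X), (∀ i, MeasurableSet (B i)) →
    Pairwise (fun i j => Disjoint (B i) (B j)) →
    iIndepFun (fun (i : Fin n) (ω : Ω) => (η ω).1 (B i)) P

/-- The product measure `ν^ι` on `ι → X`, for a finite index set `ι`. -/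
abbrev powMeasure {X : Type*} [MeasurableSpace X] (ι : Type*) [Fintype ι] (ν : Measure X) :
    Measure (ι → X) :=
  Measure.pi (fun _ : ι => ν)

/-- The minimum over nonempty `J ⊆ {1, …, k}` of the infimum, over measurable `V ⊆ U` with
`ν^k(V) ≥ ν^k(U) / 2^(k+1)`, of `ν^|J|(Π_J(V))`. Here `Π_J` is the projection
`J.restrict : X^k → X^J`, and `Π_J(V)`, which need not be measurable, is measured by the outer
measure of `ν^|J|` (this is what applying a Mathlib measure to an arbitrary set means). -/
def minProjection {X : Type*} [MeasurableSpace X] (ν : Measure X) (k : ℕ)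
    (U : Set (Fin k → X)) : ℝ≥0∞ :=
  ⨅ (J : Finset (Fin k)) (_ : J.Nonempty) (V : Set (Fin k → X)) (_ : MeasurableSet V)
    (_ : V ⊆ U) (_ : powMeasure (Fin k) ν U / 2 ^ (k + 1) ≤ powMeasure (Fin k) ν V),
    powMeasure J ν (J.restrict '' V)

end

/-!
The proof rests on the lower bound `t² λⁿ{|w| ≥ t} ≤ n! Var F`, for `t > 0` and `n ≥ 1`, where
`w(y₁, …, yₙ) = E D_{y₁} ⋯ D_{yₙ} f(η)` is the expected iterated add-one cost
(`IsPoissonProcess.mul_powMeasure_le_variance`). It is a Chebyshev-type consequence of the `n`-th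
term of the Fock space expansion `Var F = ∑ ‖w_n‖² / n!`, but the expansion itself is not needed.
For a bounded symmetric kernel `g` the multiple Wiener–Itô integral `Iₙ(g)` is centred and satisfies
`E[f(η) Iₙ(g)] = ∫ g w dλⁿ` and `E[Iₙ(g)²] = n! ∫ g² dλⁿ`, so that `E[(f(η) - E f(η) - Iₙ(g))²] ≥ 0`
reads `2 ∫ g w dλⁿ - n! ∫ g² dλⁿ ≤ Var F`; the kernel `g = (t² / n!) w⁻¹ 1{|w| ≥ t}` gives the bound.

The multiple integrals are built pathwise, on a set `B` of finite intensity. There the law of `η`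
is that of an explicit Poisson sample (`poissonSample`) plus the restriction of `η` to the complement
of `B`, independent of the sample (`IsPoissonProcess.map_eq_map_addMultiset`), which is seen from the characteristic functionals.
A sample is a finite multiset of points. On functionals of finite multisets the add-one cost and
the Skorohod integral `δ(u)(M) = ∑_{z ∈ M} u(z, M - δ_z) - ∫ u(z, M) λ(dz)` are plain algebraic
operations, and the multiple integral is the iterated Skorohod integral (`wienerIto`). The Mecke
equation (`lintegral_removeSum`) is Fubini's theorem for a sample; it gives the duality of the two
operations, hence `integral_mul_wienerIto`. The isometry follows from the duality and from
`D_y Iₙ(g) = n! g(y)` (`iterCost_wienerIto`). The sets `B` are then let increase to the whole space.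

For the theorem, `f(η + ∑_{i ∈ I} δ_{x_i}) = ∑_{J ⊆ I} D_{x_J} f(η)`, so the hypothesis on `U` forces
`|w(x_J)| ≥ t = c / 2^(k+1)` for some nonempty `J`, for almost every `x ∈ U`
(`exists_le_abs_iterCost`). One of the sets `V_J = {x ∈ U : |w(x_J)| ≥ t}` therefore carries the
proportion `2^{-(k+1)}` of the measure of `U`. Its projection `Π_J(V_J)` lies in `{|w| ≥ t}`, whose
measure is bounded by `|J|! Var F / t²`.
-/

/-! ### Functionals of finite multisets -/

section Multisets

variable {X : Type*}

/-- The multiset of the values of a finite family, that is, the finite point configuration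
formed by the coordinates of `y`. -/
def points {ι : Type*} [Fintype ι] (y : ι → X) : Multiset X :=
  Finset.univ.val.map y

lemma card_points {ι : Type*} [Fintype ι] (y : ι → X) :
    (points y).card = Fintype.card ι := by
  simp [points]

lemma points_get (l : List X) : points (fun i : Fin l.length => l.get i) = l := by
  have : points (fun i : Fin l.length => l.get i) = ((List.ofFn l.get : List X) : Multiset X) := by
    rw [points, List.ofFn_eq_map]
    rfl
  exact this.trans (by simp)

lemma exists_points_eq (M : Multiset X) : ∃ x : Fin M.card → X, points x = M := by
  obtain ⟨l, rfl⟩ : ∃ l : List X, (l : Multiset X) = M := ⟨M.toList, M.coe_toList⟩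
  exact ⟨fun i => l.get i, points_get l⟩

lemma points_cons {n : ℕ} (z : X) (y : Fin n → X) :
    points (Fin.cons z y : Fin (n + 1) → X) = z ::ₘ points y := by
  simp [points, Fin.univ_succ, Function.comp_def]

lemma points_comp_equiv {ι κ : Type*} [Fintype ι] [Fintype κ] (e : ι ≃ κ) (y : κ → X) :
    points (y ∘ e) = points y := by
  have h : (Finset.univ : Finset ι).val.map e = (Finset.univ : Finset κ).val := by
    simp
  rw [points, points, ← h, Multiset.map_map]

lemma points_removeNth {n : ℕ} (x : Fin (n + 1) → X) (i : Fin (n + 1)) :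
    points x = x i ::ₘ points (i.removeNth x) := by
  have h : (Finset.univ : Finset (Fin (n + 1))) = _ := Fin.univ_succAbove n i
  rw [points, h]
  simp only [points, Finset.cons_val, Multiset.map_cons, Finset.map_val, Multiset.map_map]
  rfl

open Classical in
/-- The sum `∑_{z ∈ M} u z (M - z)` over the points of `M`, counted with multiplicity. It is the
integral of `z ↦ u z (M - δ_z)` against the counting measure `M`. -/
noncomputable def removeSum {R : Type*} [AddCommMonoid R] (u : X → Multiset X → R) (M : Multiset X) : R :=
  (M.map fun z => u z (M.erase z)).sum

lemma removeSum_zero {R : Type*} [AddCommMonoid R] (u : X → Multiset X → R) :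
    removeSum u 0 = 0 := by
  simp [removeSum]

lemma removeSum_points {R : Type*} [AddCommMonoid R] (u : X → Multiset X → R) {n : ℕ}
    (x : Fin (n + 1) → X) :
    removeSum u (points x) = ∑ i, u (x i) (points (i.removeNth x)) := by
  classical
  have h (i : Fin (n + 1)) : u (x i) (points (i.removeNth x)) =
      u (x i) ((points x).erase (x i)) := by
    rw [points_removeNth x i, Multiset.erase_cons_head]
  simp_rw [h]
  simp only [removeSum]
  conv_lhs => rw [show points x = Finset.univ.val.map x from rfl]
  rw [Multiset.map_map]
  rfl

lemma removeSum_cons {R : Type*} [AddCommMonoid R] (u : X → Multiset X → R) (z : X)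
    (M : Multiset X) :
    removeSum u (z ::ₘ M) = u z M + removeSum (fun w N => u w (z ::ₘ N)) M := by
  classical
  simp only [removeSum, Multiset.map_cons, Multiset.sum_cons, Multiset.erase_cons_head]
  congr 2
  refine Multiset.map_congr rfl fun w hw => ?_
  rw [Multiset.erase_cons_tail_of_mem hw]

lemma mul_removeSum {R : Type*} [NonUnitalNonAssocSemiring R] (H : Multiset X → R)
    (u : X → Multiset X → R) (M : Multiset X) :
    H M * removeSum u M = removeSum (fun z N => H (z ::ₘ N) * u z N) M := by
  classical
  simp only [removeSum]
  rw [← Multiset.sum_map_mul_left]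
  congr 1
  refine Multiset.map_congr rfl fun w hw => ?_
  rw [Multiset.cons_erase hw]

lemma removeSum_sub (u v : X → Multiset X → ℝ) (M : Multiset X) :
    removeSum (fun z N => u z N - v z N) M = removeSum u M - removeSum v M := by
  simp [removeSum, Multiset.sum_map_sub]

lemma removeSum_const_mul {R : Type*} [NonUnitalNonAssocSemiring R] (c : R)
    (u : X → Multiset X → R) (M : Multiset X) :
    removeSum (fun z N => c * u z N) M = c * removeSum u M := by
  simp [removeSum, Multiset.sum_map_mul_left]

lemma abs_removeSum_le (u : X → Multiset X → ℝ) (M : Multiset X) :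
    |removeSum u M| ≤ removeSum (fun z N => |u z N|) M := by
  unfold removeSum
  exact Multiset.abs_sum_le_sum_abs.trans_eq (by rw [Multiset.map_map]; rfl)

lemma removeSum_mono {R : Type*} [AddCommMonoid R] [PartialOrder R] [IsOrderedAddMonoid R]
    {u v : X → Multiset X → R} {M : Multiset X}
    (h : ∀ z N, N.card + 1 = M.card → u z N ≤ v z N) : removeSum u M ≤ removeSum v M := by
  classical
  unfold removeSum
  refine Multiset.sum_map_le_sum_map _ _ fun w hw => h _ _ ?_
  rw [Multiset.card_erase_add_one hw]

lemma removeSum_card {R : Type*} [Semiring R] (κ : ℕ → R) (M : Multiset X) :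
    removeSum (fun _ N => κ N.card) M = M.card * κ (M.card - 1) := by
  classical
  unfold removeSum
  rw [Multiset.map_congr rfl (g := fun _ => κ (M.card - 1))]
  · simp
  · intro w hw
    simp only [Multiset.card_erase_of_mem hw, Nat.pred_eq_sub_one]

/-- The add-one-cost operator `D_z H (M) = H (M + δ_z) - H (M)`. -/
def addOneCost (z : X) (H : Multiset X → ℝ) (M : Multiset X) : ℝ :=
  H (z ::ₘ M) - H M

/-- The iterated add-one-cost operator `D_{y₁} ⋯ D_{yₙ}` for the multiset `Y = {y₁, …, yₙ}`,
written as an alternating sum over the sub-multisets of `Y`. -/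
def iterCost (Y : Multiset X) (H : Multiset X → ℝ) (M : Multiset X) : ℝ :=
  (Y.powerset.map fun A => (-1) ^ (Y.card + A.card) * H (A + M)).sum

lemma iterCost_zero (H : Multiset X → ℝ) : iterCost 0 H = H := by
  funext M
  simp [iterCost]

lemma iterCost_cons (z : X) (Y : Multiset X) (H : Multiset X → ℝ) :
    iterCost (z ::ₘ Y) H = iterCost Y (addOneCost z H) := by
  funext M
  simp only [iterCost, addOneCost, Multiset.powerset_cons, Multiset.map_add, Multiset.sum_add,
    Multiset.map_map, Function.comp_def, Multiset.card_cons, mul_sub, Multiset.sum_map_sub,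
    Multiset.cons_add]
  rw [sub_eq_add_neg, add_comm, ← Multiset.sum_map_neg]
  congr 3
  · funext A
    ring
  · funext A
    ring

lemma iterCost_const_mul (c : ℝ) (Y : Multiset X) (H : Multiset X → ℝ) (M : Multiset X) :
    iterCost Y (fun N => c * H N) M = c * iterCost Y H M := by
  simp only [iterCost]
  rw [← Multiset.sum_map_mul_left]
  congr 2
  funext A
  ring

lemma iterCost_const (c : ℝ) {Y : Multiset X} (hY : Y ≠ 0) (M : Multiset X) :
    iterCost Y (fun _ => c) M = 0 := by
  obtain ⟨z, hz⟩ := Multiset.exists_mem_of_ne_zero hY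
  obtain ⟨Y', rfl⟩ := Multiset.exists_cons_of_mem hz
  rw [iterCost_cons]
  simp [iterCost, addOneCost]

/-- The sum of `a (A + M)` over the sub-multisets `A` of `Y`; it dominates `iterCost Y`. -/
noncomputable def subsetSum (Y : Multiset X) (a : Multiset X → ℝ≥0∞) (M : Multiset X) : ℝ≥0∞ :=
  (Y.powerset.map fun A => a (A + M)).sum

lemma subsetSum_zero (a : Multiset X → ℝ≥0∞) : subsetSum 0 a = a := by
  funext M
  simp [subsetSum]

lemma subsetSum_cons (z : X) (Y : Multiset X) (a : Multiset X → ℝ≥0∞) :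
    subsetSum (z ::ₘ Y) a = subsetSum Y (fun M => a M + a (z ::ₘ M)) := by
  funext M
  simp only [subsetSum, Multiset.powerset_cons, Multiset.map_add, Multiset.sum_add,
    Multiset.map_map, Function.comp_def, Multiset.sum_map_add, Multiset.cons_add]

lemma le_subsetSum {Y A : Multiset X} (h : A ≤ Y) (a : Multiset X → ℝ≥0∞) (M : Multiset X) :
    a (A + M) ≤ subsetSum Y a M := by
  unfold subsetSum
  refine Multiset.single_le_sum (fun _ _ => zero_le) _ ?_
  exact Multiset.mem_map_of_mem (fun A => a (A + M)) (Multiset.mem_powerset.2 h)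

lemma enorm_iterCost_le (Y : Multiset X) (H : Multiset X → ℝ) (M : Multiset X) :
    ‖iterCost Y H M‖ₑ ≤ subsetSum Y (fun N => ‖H N‖ₑ) M := by
  unfold iterCost subsetSum
  generalize Y.powerset = T
  induction T using Multiset.induction_on with
  | empty => simp
  | cons A T ih =>
    simp only [Multiset.map_cons, Multiset.sum_cons]
    refine (enorm_add_le _ _).trans (add_le_add ?_ ih)
    simp [enorm_mul]

/-- The Möbius inversion `H (∑_{i ∈ I} δ_{x_i}) = ∑_{J ⊆ I} D_{x_J} H (0)`. -/
lemma eq_sum_iterCost {ι : Type*} [DecidableEq ι] (x : ι → X) (I : Finset ι)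
    (H : Multiset X → ℝ) (M : Multiset X) :
    H (I.val.map x + M) = ∑ J ∈ I.powerset, iterCost (J.val.map x) H M := by
  induction I using Finset.induction_on generalizing H with
  | empty => simp [iterCost_zero]
  | insert a s ha ih =>
    rw [Finset.sum_powerset_insert ha, Finset.insert_val_of_notMem ha, Multiset.map_cons,
      Multiset.cons_add]
    have h : ∀ J ∈ s.powerset, iterCost ((insert a J).val.map x) H M
        = iterCost (J.val.map x) (addOneCost (x a) H) M := by
      intro J hJ
      rw [Finset.insert_val_of_notMem fun h => ha (Finset.mem_powerset.1 hJ h),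
        Multiset.map_cons, iterCost_cons]
    rw [Finset.sum_congr rfl h, ← ih, ← ih]
    simp [addOneCost]

end Multisets

/-! ### Measurability of functionals with parameters -/

section Measurability

universe u v

variable {X : Type u} [MeasurableSpace X]

/-- Joint measurability of a functional of a finite multiset which depends on a parameter: it is
jointly measurable in the parameter and in the coordinates, for each number of points. -/
def JointlyMeasurable {A : Type*} [MeasurableSpace A] {R : Type*} [MeasurableSpace R]
    (H : A → Multiset X → R) : Prop :=
  ∀ n, Measurable fun p : A × (Fin n → X) => H p.1 (points p.2)

variable {A : Type*} [MeasurableSpace A] {R : Type*} [MeasurableSpace R]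

lemma JointlyMeasurable.comp {A' : Type*} [MeasurableSpace A'] {H : A → Multiset X → R}
    (hH : JointlyMeasurable H) {κ : A' → A} (hκ : Measurable κ) :
    JointlyMeasurable fun a => H (κ a) := fun n =>
  (hH n).comp (by fun_prop : Measurable fun p : A' × (Fin n → X) => (κ p.1, p.2))

lemma measurable_cons {A : Type*} [MeasurableSpace A] {n : ℕ} {z : A → X} {y : A → Fin n → X}
    (hz : Measurable z) (hy : Measurable y) :
    Measurable fun a => (Fin.cons (z a) (y a) : Fin (n + 1) → X) := by
  rw [measurable_pi_iff]
  intro i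
  refine Fin.cases ?_ (fun i => ?_) i
  · simpa using hz
  · simpa using (measurable_pi_iff.1 hy) i

lemma JointlyMeasurable.cons {H : A → Multiset X → R} (hH : JointlyMeasurable H) :
    JointlyMeasurable fun (p : A × X) M => H p.1 (p.2 ::ₘ M) := by
  intro n
  have h : Measurable fun q : (A × X) × (Fin n → X) =>
      (q.1.1, (Fin.cons q.1.2 q.2 : Fin (n + 1) → X)) :=
    (by fun_prop : Measurable fun q : (A × X) × (Fin n → X) => q.1.1).prodMk
      (measurable_cons (by fun_prop) (by fun_prop))
  simpa [Function.comp_def, points_cons] using (hH (n + 1)).comp h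

lemma measurable_removeNth {n : ℕ} (i : Fin (n + 1)) :
    Measurable fun x : Fin (n + 1) → X => i.removeNth x := by
  rw [measurable_pi_iff]
  intro j
  simpa [Fin.removeNth] using measurable_pi_apply (i.succAbove j)

lemma JointlyMeasurable.removeSum [AddCommMonoid R] [MeasurableAdd₂ R]
    {u : A → X → Multiset X → R} (hu : JointlyMeasurable fun p : A × X => u p.1 p.2) :
    JointlyMeasurable fun a => removeSum (u a) := by
  intro n
  cases n with
  | zero =>
    have h (x : Fin 0 → X) : points x = 0 := by simp [points]
    simp only [h, removeSum_zero]
    exact measurable_const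
  | succ n =>
    simp only [removeSum_points]
    refine Finset.measurable_fun_sum _ fun i _ => ?_
    have h : Measurable fun q : A × (Fin (n + 1) → X) => ((q.1, q.2 i), i.removeNth q.2) :=
      (measurable_fst.prodMk ((measurable_pi_apply i).comp measurable_snd)).prodMk
        ((measurable_removeNth i).comp measurable_snd)
    exact (hu n).comp h

lemma JointlyMeasurable.integral {u : A → X → Multiset X → ℝ}
    (hu : JointlyMeasurable fun p : A × X => u p.1 p.2) (m : Measure X) [SFinite m] :
    JointlyMeasurable fun a M => ∫ z, u a z M ∂m := by
  intro n
  have h : Measurable fun q : (A × (Fin n → X)) × X => u q.1.1 q.2 (points q.1.2) :=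
    (hu n).comp (by fun_prop :
      Measurable fun q : (A × (Fin n → X)) × X => ((q.1.1, q.2), q.1.2))
  exact h.stronglyMeasurable.integral_prod_right.measurable

/-- The `n`-fold Wiener–Itô integral, with respect to the compensated point configuration `M - m`,
of the symmetric kernel `g`. A symmetric kernel in `n` variables is given as a function on
multisets, of which only the values at multisets of cardinality `n` matter. The recursion is
`Iₙ₊₁(g) = δ(z ↦ Iₙ(g(z, ·)))`, with the pathwise Skorohod integral
`δ(u)(M) = ∑_{z ∈ M} u z (M - δ_z) - ∫ u z M dm(z)`. -/
noncomputable def wienerIto (m : Measure X) : ℕ → (Multiset X → ℝ) → Multiset X → ℝ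
  | 0, g, _ => g 0
  | n + 1, g, M => removeSum (fun z => wienerIto m n fun N => g (z ::ₘ N)) M
      - ∫ z, wienerIto m n (fun N => g (z ::ₘ N)) M ∂m

lemma JointlyMeasurable.wienerIto (m : Measure X) [SFinite m] (n : ℕ) {A : Type u}
    [MeasurableSpace A] {g : A → Multiset X → ℝ} (hg : JointlyMeasurable g) :
    JointlyMeasurable fun a => wienerIto m n (g a) := by
  induction n generalizing A with
  | zero =>
    intro n
    have h : Measurable fun q : A × (Fin n → X) => (q.1, (Fin.elim0 : Fin 0 → X)) := by fun_prop
    have h0 : points (Fin.elim0 : Fin 0 → X) = 0 := by simp [points]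
    simpa [_root_.wienerIto, Function.comp_def, h0] using (hg 0).comp h
  | succ n ih =>
    have h := ih hg.cons
    intro k
    exact (JointlyMeasurable.removeSum (u := fun a z => _root_.wienerIto m n fun N => g a (z ::ₘ N))
      h k).sub (JointlyMeasurable.integral
      (u := fun a z => _root_.wienerIto m n fun N => g a (z ::ₘ N)) h m k)

lemma abs_wienerIto_le (m : Measure X) [IsFiniteMeasure m] (n : ℕ) {g : Multiset X → ℝ} {C : ℝ}
    (hC : ∀ M, |g M| ≤ C) (M : Multiset X) :
    |wienerIto m n g M| ≤ C * (1 + m.real Set.univ) ^ n * 2 ^ (n * M.card) := by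
  have hC0 : 0 ≤ C := (abs_nonneg _).trans (hC 0)
  induction n generalizing g M with
  | zero => simpa [wienerIto] using hC 0
  | succ n ih =>
    set b := m.real Set.univ with hb
    have hb0 : 0 ≤ b := measureReal_nonneg
    set K := C * (1 + b) ^ n with hK
    have hK0 : 0 ≤ K := by positivity
    have ih' (z : X) (N : Multiset X) := ih (g := fun N => g (z ::ₘ N)) (M := N) fun N => hC _
    have h1 : |removeSum (fun z => wienerIto m n fun N => g (z ::ₘ N)) M|
        ≤ K * 2 ^ ((n + 1) * M.card) := by
      refine (abs_removeSum_le _ _).trans ?_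
      calc _ ≤ removeSum (fun _ N => K * 2 ^ (n * N.card)) M :=
            removeSum_mono fun z N _ => ih' z N
        _ = M.card * (K * 2 ^ (n * (M.card - 1))) :=
            removeSum_card (fun j => K * 2 ^ (n * j)) M
        _ ≤ 2 ^ M.card * (K * 2 ^ (n * M.card)) := by
            have h2 : (M.card : ℝ) ≤ 2 ^ M.card := by exact_mod_cast Nat.lt_two_pow_self.le
            gcongr
            · norm_num
            · omega
        _ = K * 2 ^ ((n + 1) * M.card) := by ring
    have h2 : |∫ z, wienerIto m n (fun N => g (z ::ₘ N)) M ∂m| ≤ K * 2 ^ (n * M.card) * b :=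
      norm_integral_le_of_norm_le_const (μ := m)
        (f := fun z => wienerIto m n (fun N => g (z ::ₘ N)) M)
        (Filter.Eventually.of_forall fun z => ih' z M)
    calc _ ≤ K * 2 ^ ((n + 1) * M.card) + K * 2 ^ (n * M.card) * b :=
          (abs_sub _ _).trans (add_le_add h1 h2)
      _ ≤ K * 2 ^ ((n + 1) * M.card) + K * 2 ^ ((n + 1) * M.card) * b := by
          gcongr
          · norm_num
          · omega
      _ = _ := by rw [hK]; ring

lemma JointlyMeasurable.measurable_left {H : A → Multiset X → R} (hH : JointlyMeasurable H)
    (M : Multiset X) : Measurable fun a => H a M := by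
  obtain ⟨x, hx⟩ := exists_points_eq M
  have := (hH _).comp (by fun_prop : Measurable fun a : A => (a, x))
  simpa [Function.comp_def, hx] using this

lemma integrable_wienerIto_cons (m : Measure X) [IsFiniteMeasure m] (n : ℕ)
    {g : X → Multiset X → ℝ} (hg : JointlyMeasurable g) {C : ℝ}
    (hC : ∀ z M, |g z M| ≤ C) (M : Multiset X) :
    Integrable (fun z => wienerIto m n (g z) M) m :=
  Integrable.of_bound ((hg.wienerIto m n).measurable_left M).aestronglyMeasurable _
    (Filter.Eventually.of_forall fun z => abs_wienerIto_le m n (hC z) M)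

/-- The derivative of a multiple integral: `D_z Iₙ₊₁(g) = (n + 1) Iₙ(g(z, ·))`. -/
lemma addOneCost_wienerIto (m : Measure X) [IsFiniteMeasure m] (n : ℕ) {g : Multiset X → ℝ}
    (hg : JointlyMeasurable fun _ : PUnit.{u + 1} => g) {C : ℝ} (hC : ∀ M, |g M| ≤ C) (z : X) :
    addOneCost z (wienerIto m (n + 1) g)
      = fun M => (n + 1 : ℝ) * wienerIto m n (fun N => g (z ::ₘ N)) M := by
  have hcons {g : Multiset X → ℝ} (hg : JointlyMeasurable fun _ : PUnit.{u + 1} => g) :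
      JointlyMeasurable fun (z : X) M => g (z ::ₘ M) :=
    JointlyMeasurable.comp hg.cons (κ := fun z : X => (PUnit.unit.{u + 1}, z)) (by fun_prop)
  induction n generalizing g z with
  | zero =>
    funext M
    simp [addOneCost, wienerIto, removeSum_cons]
  | succ n ih =>
    funext M
    set u : X → Multiset X → ℝ := fun w => wienerIto m (n + 1) fun N => g (w ::ₘ N) with hu
    have hDu (w : X) (N : Multiset X) : u w (z ::ₘ N) - u w N
        = (n + 1 : ℝ) * wienerIto m n (fun N => g (z ::ₘ w ::ₘ N)) N := by
      have := congrFun (ih (g := fun N => g (w ::ₘ N))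
        ((hcons hg).comp (measurable_const (a := w))) (fun M => hC _) z) N
      simp only [addOneCost] at this
      simp only [hu, this, Multiset.cons_swap]
    have hint (N : Multiset X) : Integrable (fun w => u w N) m :=
      integrable_wienerIto_cons m (n + 1) (hcons hg) (fun z M => hC _) N
    have e1 : addOneCost z (wienerIto m (n + 1 + 1) g) M
        = removeSum u (z ::ₘ M) - removeSum u M
          - (∫ w, u w (z ::ₘ M) ∂m - ∫ w, u w M ∂m) := by
      simp only [addOneCost, wienerIto, hu]
      ring
    rw [e1, removeSum_cons, add_sub_assoc, ← removeSum_sub, ← integral_sub (hint _) (hint _)]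
    simp only [hDu]
    rw [removeSum_const_mul, integral_const_mul, add_sub_assoc, ← mul_sub]
    have e2 : removeSum (fun w N => wienerIto m n (fun N => g (z ::ₘ w ::ₘ N)) N) M
        - ∫ w, wienerIto m n (fun N => g (z ::ₘ w ::ₘ N)) M ∂m
        = wienerIto m (n + 1) (fun N => g (z ::ₘ N)) M := rfl
    rw [e2]
    simp only [hu]
    push_cast
    ring

/-- The top-order derivative of a multiple integral is deterministic: `D_Y Iₙ(g) = n! g(Y)`. -/
lemma iterCost_wienerIto (m : Measure X) [IsFiniteMeasure m] {n : ℕ} {g : Multiset X → ℝ}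
    (hg : JointlyMeasurable fun _ : PUnit.{u + 1} => g) {C : ℝ} (hC : ∀ M, |g M| ≤ C)
    {Y : Multiset X} (hY : Y.card = n) (M : Multiset X) :
    iterCost Y (wienerIto m n g) M = n ! * g Y := by
  induction n generalizing g Y with
  | zero =>
    rw [Multiset.card_eq_zero] at hY
    simp [hY, iterCost_zero, wienerIto]
  | succ n ih =>
    obtain ⟨z, hz⟩ := Multiset.card_pos_iff_exists_mem.1 (by omega : 0 < Y.card)
    obtain ⟨Y', rfl⟩ := Multiset.exists_cons_of_mem hz
    rw [iterCost_cons, addOneCost_wienerIto m n hg hC, iterCost_const_mul,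
      ih (JointlyMeasurable.comp hg.cons (κ := fun _ : PUnit.{u + 1} => (PUnit.unit.{u + 1}, z))
        (by fun_prop)) (fun M => hC _) (by simpa using hY)]
    push_cast [Nat.factorial_succ]
    ring

end Measurability

/-! ### Poisson samples with finite intensity and the Mecke equation -/

section Sample

universe u

variable {X : Type u} [MeasurableSpace X]

lemma measurableEmbedding_sigmaMk (n : ℕ) :
    MeasurableEmbedding (Sigma.mk (β := fun n => Fin n → X) n) := by
  have hmeas (k : ℕ) : Measurable (Sigma.mk (β := fun n => Fin n → X) k) :=
    Measurable.of_le_map (iInf_le _ k)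
  refine ⟨sigma_mk_injective, hmeas n, fun {s} hs => ?_⟩
  have hpre (k : ℕ) : MeasurableSet (Sigma.mk (β := fun n => Fin n → X) k ⁻¹'
      (Sigma.mk (β := fun n => Fin n → X) n '' s)) := by
    by_cases h : n = k
    · subst h
      rwa [Set.preimage_image_eq _ sigma_mk_injective]
    · convert MeasurableSet.empty
      ext x
      simp only [Set.mem_preimage, Set.mem_image, Set.mem_empty_iff_false, iff_false]
      rintro ⟨y, -, hy⟩
      exact h (congrArg Sigma.fst hy)
  exact MeasurableSpace.measurableSet_iInf.2 hpre

lemma measurable_prod_sigma {A R : Type*} [MeasurableSpace A] [MeasurableSpace R]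
    {F : A × (Σ n, Fin n → X) → R}
    (hF : ∀ n, Measurable fun p : A × (Fin n → X) => F (p.1, ⟨n, p.2⟩)) : Measurable F := by
  intro E hE
  have h : F ⁻¹' E = ⋃ n, Prod.map id (Sigma.mk n) ''
      ((fun p : A × (Fin n → X) => F (p.1, ⟨n, p.2⟩)) ⁻¹' E) := by
    ext ⟨a, n, x⟩
    simp only [Set.mem_preimage, Set.mem_iUnion, Set.mem_image, Prod.exists, Prod.map_apply, id,
      Prod.mk.injEq]
    constructor
    · exact fun h => ⟨n, a, x, h, rfl, rfl⟩
    · rintro ⟨k, b, y, h, rfl, h'⟩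
      rwa [h'] at h
  rw [h]
  exact MeasurableSet.iUnion fun n =>
    (MeasurableEmbedding.id.prodMap (measurableEmbedding_sigmaMk n)).measurableSet_image.2
      (hF n hE)

lemma JointlyMeasurable.measurable_prod {A R : Type*} [MeasurableSpace A] [MeasurableSpace R]
    {H : A → Multiset X → R} (hH : JointlyMeasurable H) :
    Measurable fun p : A × (Σ n, Fin n → X) => H p.1 (points p.2.2) :=
  measurable_prod_sigma hH

lemma JointlyMeasurable.measurable_right {A R : Type*} [MeasurableSpace A] [MeasurableSpace R]
    {H : A → Multiset X → R} (hH : JointlyMeasurable H) (a : A) :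
    Measurable fun s : Σ n, Fin n → X => H a (points s.2) :=
  hH.measurable_prod.comp measurable_prodMk_left

/-- The law of a Poisson sample with finite intensity measure `m`: the number of points is Poisson
distributed with parameter `m(X)`, and given that it is `n`, the points are `n` independent
variables with law proportional to `m`. So the part with `n` points is `e^{-m(X)} / n!` times the
`n`-fold product of `m`. -/
noncomputable def poissonSample (m : Measure X) : Measure (Σ n, Fin n → X) :=
  Measure.sum fun n => ENNReal.ofReal (Real.exp (-m.real Set.univ) / n !) •
    (Measure.pi fun _ : Fin n => m).map (Sigma.mk n)

lemma lintegral_poissonSample (m : Measure X) (F : (Σ n, Fin n → X) → ℝ≥0∞) :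
    ∫⁻ s, F s ∂poissonSample m = ∑' n, ENNReal.ofReal (Real.exp (-m.real Set.univ) / n !) *
      ∫⁻ x : Fin n → X, F ⟨n, x⟩ ∂Measure.pi fun _ => m := by
  rw [poissonSample, lintegral_sum_measure]
  congr 1 with n
  rw [lintegral_smul_measure, (measurableEmbedding_sigmaMk n).lintegral_map, smul_eq_mul]

/-- The number of points of a Poisson sample has exponential moments of all orders. -/
lemma lintegral_pow_poissonSample (m : Measure X) [IsFiniteMeasure m] {t : ℝ} (ht : 0 ≤ t) :
    ∫⁻ s, ENNReal.ofReal t ^ s.1 ∂poissonSample m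
      = ENNReal.ofReal (Real.exp (m.real Set.univ * (t - 1))) := by
  have hb : m Set.univ = ENNReal.ofReal (m.real Set.univ) := by simp
  rw [lintegral_poissonSample]
  set b := m.real Set.univ
  have hb0 : 0 ≤ b := measureReal_nonneg
  simp only [lintegral_const, Measure.pi_univ, Finset.prod_const, Finset.card_univ,
    Fintype.card_fin]
  have h (n : ℕ) : ENNReal.ofReal (Real.exp (-b) / n !) * (ENNReal.ofReal t ^ n * m Set.univ ^ n)
      = ENNReal.ofReal (Real.exp (-b) * ((b * t) ^ n / n !)) := by
    rw [hb, ← ENNReal.ofReal_pow ht, ← ENNReal.ofReal_pow hb0,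
      ← ENNReal.ofReal_mul (by positivity), ← ENNReal.ofReal_mul (by positivity)]
    congr 1
    ring
  simp_rw [h]
  have hs : HasSum (fun n : ℕ => Real.exp (-b) * ((b * t) ^ n / n !))
      (Real.exp (-b) * Real.exp (b * t)) := by
    have := NormedSpace.expSeries_div_hasSum_exp (𝔸 := ℝ) (b * t)
    rw [← Real.exp_eq_exp_ℝ] at this
    exact this.mul_left _
  rw [← ENNReal.ofReal_tsum_of_nonneg (fun n => by positivity) hs.summable, hs.tsum_eq,
    ← Real.exp_add]
  congr 2
  ring

instance (m : Measure X) [IsFiniteMeasure m] : IsProbabilityMeasure (poissonSample m) where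
  measure_univ := by
    have := lintegral_pow_poissonSample m (t := 1) zero_le_one
    simpa using this

lemma piFinSuccAbove_symm_zero {n : ℕ} (p : X × (Fin n → X)) :
    (MeasurableEquiv.piFinSuccAbove (fun _ : Fin (n + 1) => X) 0).symm p
      = Fin.cons p.1 p.2 := by
  have : (MeasurableEquiv.piFinSuccAbove (fun _ : Fin (n + 1) => X) 0).symm p
      = Fin.insertNth 0 p.1 p.2 := rfl
  rw [this, Fin.insertNth_zero']

lemma lintegral_pi_removeNth (m : Measure X) [SigmaFinite m] {n : ℕ} (i : Fin (n + 1))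
    {F : X × (Fin n → X) → ℝ≥0∞} (hF : Measurable F) :
    ∫⁻ x : Fin (n + 1) → X, F (x i, i.removeNth x) ∂Measure.pi (fun _ => m)
      = ∫⁻ z, ∫⁻ y, F (z, y) ∂Measure.pi (fun _ : Fin n => m) ∂m := by
  rw [← lintegral_prod _ hF.aemeasurable]
  exact (measurePreserving_piFinSuccAbove (fun _ : Fin (n + 1) => m) i).lintegral_comp hF

lemma lintegral_pi_cons (m : Measure X) [SigmaFinite m] {n : ℕ}
    {F : (Fin (n + 1) → X) → ℝ≥0∞} (hF : Measurable F) :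
    ∫⁻ x, F x ∂Measure.pi (fun _ => m)
      = ∫⁻ z, ∫⁻ y : Fin n → X, F (Fin.cons z y) ∂Measure.pi (fun _ => m) ∂m := by
  have hF' : Measurable fun p : X × (Fin n → X) => F (Fin.cons p.1 p.2) :=
    hF.comp (measurable_cons measurable_fst measurable_snd)
  rw [← lintegral_pi_removeNth m 0 hF']
  congr 1 with x
  congr 1
  exact (Fin.cons_self_tail x).symm

lemma integral_pi_cons (m : Measure X) [SigmaFinite m] {n : ℕ}
    {F : (Fin (n + 1) → X) → ℝ} (hF : Integrable F (Measure.pi fun _ => m)) :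
    ∫ x, F x ∂Measure.pi (fun _ => m)
      = ∫ z, ∫ y : Fin n → X, F (Fin.cons z y) ∂Measure.pi (fun _ => m) ∂m := by
  have hmp := (measurePreserving_piFinSuccAbove (fun _ : Fin (n + 1) => m) 0).symm
  have e : ∫ x, F x ∂Measure.pi (fun _ => m) = ∫ p, F ((MeasurableEquiv.piFinSuccAbove
      (fun _ : Fin (n + 1) => X) 0).symm p) ∂(m.prod (Measure.pi fun _ : Fin n => m)) :=
    (hmp.integral_comp' F).symm
  have hF' := (hmp.integrable_comp_emb (MeasurableEquiv.measurableEmbedding _)).2 hF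
  rw [e]
  refine (integral_prod _ hF').trans ?_
  simp only [Function.comp_apply, piFinSuccAbove_symm_zero]

/-- The Mecke equation for a Poisson sample: removing one of `n + 1` points leaves `n` points, and the
weights satisfy `(n + 1) e^{-b} / (n + 1)! = e^{-b} / n!`. -/
lemma lintegral_removeSum (m : Measure X) [IsFiniteMeasure m] {v : X → Multiset X → ℝ≥0∞}
    (hv : JointlyMeasurable v) :
    ∫⁻ s, removeSum v (points s.2) ∂poissonSample m
      = ∫⁻ z, ∫⁻ s, v z (points s.2) ∂poissonSample m ∂m := by
  simp_rw [lintegral_poissonSample]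
  have hmeas (n : ℕ) : Measurable fun z => ∫⁻ x : Fin n → X, v z (points x)
      ∂Measure.pi fun _ => m := (hv n).lintegral_prod_right'
  rw [lintegral_tsum fun n => ((hmeas n).const_mul _).aemeasurable,
    tsum_eq_zero_add' ENNReal.summable]
  have h0 (x : Fin 0 → X) : points x = 0 := by simp [points]
  simp only [h0, removeSum_zero, lintegral_zero, mul_zero, zero_add]
  congr 1 with n
  rw [lintegral_const_mul _ (hmeas n)]
  simp only [removeSum_points]
  rw [lintegral_finsetSum]
  · have h (i : Fin (n + 1)) := lintegral_pi_removeNth m i (hv n)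
    simp only at h
    simp only [h, Finset.sum_const, Finset.card_univ, Fintype.card_fin, nsmul_eq_mul]
    rw [← mul_assoc]
    congr 1
    rw [← ENNReal.ofReal_natCast, ← ENNReal.ofReal_mul (by positivity)]
    congr 1
    rw [Nat.factorial_succ]
    push_cast
    field_simp
  · exact fun i _ => (hv n).comp ((measurable_pi_apply i).prodMk (measurable_removeNth i))

omit [MeasurableSpace X] in
lemma map_removeSum {R R' : Type*} [AddCommMonoid R] [AddCommMonoid R'] (κ : R →+ R')
    (v : X → Multiset X → R) (M : Multiset X) :
    κ (removeSum v M) = removeSum (fun z N => κ (v z N)) M := by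
  simp only [removeSum, map_multiset_sum, Multiset.map_map]
  rfl

/-- The Mecke equation for a nonnegative, finite integrand. -/
lemma integral_removeSum_nnreal (m : Measure X) [IsFiniteMeasure m]
    {v : X → Multiset X → NNReal} (hv : JointlyMeasurable v)
    (hfin : ∫⁻ z, ∫⁻ s, v z (points s.2) ∂poissonSample m ∂m ≠ ∞) :
    Integrable (fun s => removeSum (fun z N => (v z N : ℝ)) (points s.2)) (poissonSample m) ∧
    ∫ s, removeSum (fun z N => (v z N : ℝ)) (points s.2) ∂poissonSample m
      = (∫⁻ z, ∫⁻ s, v z (points s.2) ∂poissonSample m ∂m).toReal := by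
  have hv' : JointlyMeasurable fun z N => (v z N : ℝ≥0∞) := fun n => (hv n).coe_nnreal_ennreal
  have e (s : Σ n, Fin n → X) : removeSum (fun z N => (v z N : ℝ)) (points s.2)
      = (removeSum (fun z N => (v z N : ℝ≥0∞)) (points s.2)).toReal := by
    have h1 := map_removeSum NNReal.toRealHom.toAddMonoidHom v (points s.2)
    have h2 := map_removeSum ENNReal.ofNNRealHom.toAddMonoidHom v (points s.2)
    simp only [RingHom.toAddMonoidHom_eq_coe, AddMonoidHom.coe_coe, NNReal.coe_toRealHom,
      ENNReal.coe_ofNNRealHom] at h1 h2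
    exact h1.symm.trans (congrArg ENNReal.toReal h2)
  have hm : Measurable fun s : Σ n, Fin n → X =>
      removeSum (fun z N => (v z N : ℝ≥0∞)) (points s.2) :=
    (JointlyMeasurable.removeSum (A := PUnit.{u + 1}) (u := fun _ z N => (v z N : ℝ≥0∞))
      (hv'.comp measurable_snd)).measurable_right PUnit.unit
  have hI := lintegral_removeSum m hv'
  simp only [e]
  rw [← hI] at hfin ⊢
  exact ⟨integrable_toReal_of_lintegral_ne_top hm.aemeasurable hfin,
    integral_toReal hm.aemeasurable (ae_lt_top hm hfin)⟩

/-- The Mecke equation for an integrable integrand. -/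
lemma integral_removeSum (m : Measure X) [IsFiniteMeasure m] {v : X → Multiset X → ℝ}
    (hv : JointlyMeasurable v)
    (hint : Integrable (fun p : X × (Σ n, Fin n → X) => v p.1 (points p.2.2))
      (m.prod (poissonSample m))) :
    Integrable (fun s => removeSum v (points s.2)) (poissonSample m) ∧
    ∫ s, removeSum v (points s.2) ∂poissonSample m
      = ∫ p, v p.1 (points p.2.2) ∂m.prod (poissonSample m) := by
  have h1 : JointlyMeasurable fun z N => (v z N).toNNReal := fun n => (hv n).real_toNNReal
  have h2 : JointlyMeasurable fun z N => (-v z N).toNNReal :=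
    fun n => (hv n).neg.real_toNNReal
  have p1 := lintegral_prod (μ := m) (ν := poissonSample m) _
    h1.measurable_prod.coe_nnreal_ennreal.aemeasurable
  have p2 := lintegral_prod (μ := m) (ν := poissonSample m) _
    h2.measurable_prod.coe_nnreal_ennreal.aemeasurable
  have f1 : ∫⁻ p, ENNReal.ofReal (v p.1 (points p.2.2)) ∂m.prod (poissonSample m) ≠ ∞ :=
    (hint.lintegral_lt_top).ne
  have f2 : ∫⁻ p, ENNReal.ofReal (-v p.1 (points p.2.2)) ∂m.prod (poissonSample m) ≠ ∞ :=
    (hint.neg.lintegral_lt_top).ne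
  obtain ⟨i1, e1⟩ := integral_removeSum_nnreal m h1 (by rw [← p1]; exact f1)
  obtain ⟨i2, e2⟩ := integral_removeSum_nnreal m h2 (by rw [← p2]; exact f2)
  have e (M : Multiset X) : removeSum v M
      = removeSum (fun z N => ((v z N).toNNReal : ℝ)) M
        - removeSum (fun z N => ((-v z N).toNNReal : ℝ)) M := by
    rw [← removeSum_sub]
    congr 1
    funext z N
    simp only [Real.coe_toNNReal']
    exact (max_zero_sub_max_neg_zero_eq_self _).symm
  simp only [e]
  refine ⟨i1.sub i2, ?_⟩
  rw [integral_sub i1 i2, e1, e2, ← p1, ← p2,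
    integral_eq_lintegral_pos_part_sub_lintegral_neg_part hint]
  rfl

end Sample

/-! ### Moment bounds and the duality between iterated costs and multiple integrals -/

section Duality

universe u

variable {X : Type u} [MeasurableSpace X]

lemma JointlyMeasurable.cons_left {R : Type*} [MeasurableSpace R] {H : Multiset X → R}
    (hH : JointlyMeasurable fun _ : PUnit.{u + 1} => H) :
    JointlyMeasurable fun (z : X) M => H (z ::ₘ M) :=
  JointlyMeasurable.comp hH.cons (κ := fun z : X => (PUnit.unit.{u + 1}, z)) (by fun_prop)

lemma JointlyMeasurable.const_left {A R : Type*} [MeasurableSpace A] [MeasurableSpace R]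
    {H : Multiset X → R} (hH : JointlyMeasurable fun _ : PUnit.{u + 1} => H) :
    JointlyMeasurable fun (_ : A) => H :=
  hH.comp (κ := fun _ : A => PUnit.unit.{u + 1}) measurable_const

lemma JointlyMeasurable.subsetSum {A : Type u} [MeasurableSpace A] {a : A → Multiset X → ℝ≥0∞}
    (ha : JointlyMeasurable a) (n : ℕ) :
    JointlyMeasurable fun (p : A × (Fin n → X)) M => subsetSum (points p.2) (a p.1) M := by
  induction n generalizing A with
  | zero =>
    have h0 (x : Fin 0 → X) : points x = 0 := by simp [points]
    simp only [h0, subsetSum_zero]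
    exact ha.comp measurable_fst
  | succ n ih =>
    have h1 : JointlyMeasurable fun (p : A × X) M => a p.1 M + a p.1 (p.2 ::ₘ M) :=
      fun k => (ha.comp measurable_fst k).add (ha.cons k)
    have h2 := (ih h1).comp (κ := fun p : A × (Fin (n + 1) → X) => ((p.1, p.2 0), Fin.tail p.2))
      ((measurable_fst.prodMk ((measurable_pi_apply 0).comp measurable_snd)).prodMk
        ((measurable_removeNth 0).comp measurable_snd))
    convert h2 using 3 with p M
    rw [← subsetSum_cons, ← points_cons, Fin.cons_self_tail]

lemma JointlyMeasurable.iterCost {A : Type u} [MeasurableSpace A] {H : A → Multiset X → ℝ}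
    (hH : JointlyMeasurable H) (n : ℕ) :
    JointlyMeasurable fun (p : A × (Fin n → X)) M => iterCost (points p.2) (H p.1) M := by
  induction n generalizing A with
  | zero =>
    have h0 (x : Fin 0 → X) : points x = 0 := by simp [points]
    simp only [h0, iterCost_zero]
    exact hH.comp measurable_fst
  | succ n ih =>
    have h1 : JointlyMeasurable fun (p : A × X) M => H p.1 (p.2 ::ₘ M) - H p.1 M :=
      fun k => (hH.cons k).sub (hH.comp measurable_fst k)
    have h2 := (ih h1).comp (κ := fun p : A × (Fin (n + 1) → X) => ((p.1, p.2 0), Fin.tail p.2))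
      ((measurable_fst.prodMk ((measurable_pi_apply 0).comp measurable_snd)).prodMk
        ((measurable_removeNth 0).comp measurable_snd))
    convert h2 using 3 with p M
    change _ = _root_.iterCost _ (addOneCost _ _) M
    rw [← iterCost_cons, ← points_cons, Fin.cons_self_tail]

/-- A functional `a` has all exponential moments under the Poisson sample if
`E[a(ζ) 2^{p |ζ|}] < ∞` for every `p`, where `|ζ|` is the number of points. This class contains
`L²` and is stable under adding a point, for almost every location of that point. -/
def HasExpMoments (m : Measure X) (a : Multiset X → ℝ≥0∞) : Prop :=
  ∀ p : ℕ, ∫⁻ s, a (points s.2) * 2 ^ (p * s.1) ∂poissonSample m ≠ ∞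

lemma JointlyMeasurable.mul_pow {A : Type*} [MeasurableSpace A] {a : A → Multiset X → ℝ≥0∞}
    (ha : JointlyMeasurable a) (p : ℕ) :
    JointlyMeasurable fun t M => a t M * 2 ^ (p * M.card) := by
  intro n
  simp only [card_points, Fintype.card_fin]
  exact (ha n).mul_const _

lemma lintegral_cons_le (m : Measure X) [IsFiniteMeasure m] {a : Multiset X → ℝ≥0∞}
    (ha : JointlyMeasurable fun _ : PUnit.{u + 1} => a) (p : ℕ) :
    ∫⁻ z, ∫⁻ s, a (z ::ₘ points s.2) * 2 ^ (p * s.1) ∂poissonSample m ∂m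
      ≤ ∫⁻ s, a (points s.2) * 2 ^ ((p + 1) * s.1) ∂poissonSample m := by
  have h := lintegral_removeSum m (ha.cons_left.mul_pow p)
  simp only [card_points, Fintype.card_fin] at h
  rw [← h]
  refine lintegral_mono fun s => ?_
  have e := mul_removeSum a (fun _ N => 2 ^ (p * N.card)) (points s.2)
  change removeSum (fun z N => a (z ::ₘ N) * 2 ^ (p * N.card)) (points s.2) ≤ _
  rw [← e, removeSum_card (fun j => (2 : ℝ≥0∞) ^ (p * j)), card_points, Fintype.card_fin]
  gcongr
  calc (s.1 : ℝ≥0∞) * 2 ^ (p * (s.1 - 1)) ≤ 2 ^ s.1 * 2 ^ (p * s.1) := by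
        gcongr
        · exact_mod_cast Nat.lt_two_pow_self.le
        · norm_num
        · omega
    _ = _ := by ring

lemma lintegral_add_cons_le (m : Measure X) [IsFiniteMeasure m] {a : Multiset X → ℝ≥0∞}
    (ha : JointlyMeasurable fun _ : PUnit.{u + 1} => a) (p : ℕ) :
    ∫⁻ z, ∫⁻ s, (a (points s.2) + a (z ::ₘ points s.2)) * 2 ^ (p * s.1) ∂poissonSample m ∂m
      ≤ (1 + m Set.univ) * ∫⁻ s, a (points s.2) * 2 ^ ((p + 1) * s.1) ∂poissonSample m := by
  have hm := (ha.mul_pow p).measurable_right PUnit.unit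
  simp only [card_points, Fintype.card_fin] at hm
  simp only [add_mul (a _)]
  simp_rw [lintegral_add_left hm]
  rw [lintegral_add_left measurable_const, lintegral_const, add_comm, add_mul 1, one_mul, mul_comm _ (m Set.univ)]
  refine add_le_add (lintegral_cons_le m ha p) ?_
  gcongr
  · norm_num
  · omega

/-- The moments of the sums over sub-configurations, integrated over the added points, are
controlled by the exponential moments of the functional. -/
lemma lintegral_subsetSum_le (m : Measure X) [IsFiniteMeasure m] (n : ℕ)
    {a : Multiset X → ℝ≥0∞} (ha : JointlyMeasurable fun _ : PUnit.{u + 1} => a) (p : ℕ) :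
    ∫⁻ y : Fin n → X, ∫⁻ s, subsetSum (points y) a (points s.2) * 2 ^ (p * s.1) ∂poissonSample m
        ∂Measure.pi (fun _ => m)
      ≤ (1 + m Set.univ) ^ n * ∫⁻ s, a (points s.2) * 2 ^ ((p + n) * s.1) ∂poissonSample m := by
  induction n generalizing a with
  | zero =>
    have h0 (x : Fin 0 → X) : points x = 0 := by simp [points]
    simp [h0, subsetSum_zero]
  | succ n ih =>
    have hmeas : Measurable fun y : Fin (n + 1) → X =>
        ∫⁻ s, subsetSum (points y) a (points s.2) * 2 ^ (p * s.1) ∂poissonSample m := by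
      have h1 := ((ha.subsetSum (n + 1)).mul_pow p).comp
        (κ := fun y : Fin (n + 1) → X => (PUnit.unit.{u + 1}, y)) (by fun_prop)
      have h2 := h1.measurable_prod.lintegral_prod_right' (ν := poissonSample m)
      simpa only [card_points, Fintype.card_fin] using h2
    rw [lintegral_pi_cons m hmeas]
    simp only [points_cons, subsetSum_cons]
    have hz (z : X) : JointlyMeasurable fun (_ : PUnit.{u + 1}) M => a M + a (z ::ₘ M) :=
      fun k => (ha k).add (ha.cons_left.comp (κ := fun _ : PUnit.{u + 1} => z)
        measurable_const k)
    calc _ ≤ ∫⁻ z, (1 + m Set.univ) ^ n * ∫⁻ s, (a (points s.2) + a (z ::ₘ points s.2))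
            * 2 ^ ((p + n) * s.1) ∂poissonSample m ∂m := lintegral_mono fun z => ih (hz z)
      _ = (1 + m Set.univ) ^ n * ∫⁻ z, ∫⁻ s, (a (points s.2) + a (z ::ₘ points s.2))
            * 2 ^ ((p + n) * s.1) ∂poissonSample m ∂m := by
          rw [lintegral_const_mul' _ _ (by finiteness)]
      _ ≤ (1 + m Set.univ) ^ n * ((1 + m Set.univ)
            * ∫⁻ s, a (points s.2) * 2 ^ ((p + n + 1) * s.1) ∂poissonSample m) := by
          gcongr
          exact lintegral_add_cons_le m ha (p + n)
      _ = _ := by rw [← mul_assoc, ← pow_succ, add_assoc]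

lemma HasExpMoments.mono {m : Measure X} {a b : Multiset X → ℝ≥0∞} (hb : HasExpMoments m b)
    (h : ∀ M, a M ≤ b M) : HasExpMoments m a := fun p =>
  ne_top_of_le_ne_top (hb p) (lintegral_mono fun s => by gcongr; exact h _)

lemma HasExpMoments.ae_addOneCost {m : Measure X} [IsFiniteMeasure m] {H : Multiset X → ℝ}
    (hm : JointlyMeasurable fun _ : PUnit.{u + 1} => H)
    (hH : HasExpMoments m fun M => ‖H M‖ₑ) :
    ∀ᵐ z ∂m, HasExpMoments m fun M => ‖addOneCost z H M‖ₑ := by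
  have ha : JointlyMeasurable fun (_ : PUnit.{u + 1}) M => ‖H M‖ₑ := fun k => (hm k).enorm
  have h (p : ℕ) : ∀ᵐ z ∂m, ∫⁻ s, (‖H (points s.2)‖ₑ + ‖H (z ::ₘ points s.2)‖ₑ)
      * 2 ^ (p * s.1) ∂poissonSample m < ∞ := by
    refine ae_lt_top ?_ (ne_top_of_le_ne_top (ENNReal.mul_ne_top (by finiteness) (hH (p + 1)))
      (lintegral_add_cons_le m ha p))
    have h1 : JointlyMeasurable fun (z : X) M => ‖H M‖ₑ + ‖H (z ::ₘ M)‖ₑ :=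
      fun k => (ha.const_left k).add (ha.cons_left k)
    simpa only [card_points, Fintype.card_fin] using
      (h1.mul_pow p).measurable_prod.lintegral_prod_right' (ν := poissonSample m)
  filter_upwards [ae_all_iff.2 h] with z hz p
  refine ne_top_of_le_ne_top (hz p).ne (lintegral_mono fun s => ?_)
  gcongr
  rw [add_comm]
  exact enorm_sub_le

lemma enorm_le_ofReal_mul {x C : ℝ} {j : ℕ} (h : |x| ≤ C * 2 ^ j) :
    ‖x‖ₑ ≤ ENNReal.ofReal C * 2 ^ j := by
  rw [← ofReal_norm, Real.norm_eq_abs]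
  refine (ENNReal.ofReal_le_ofReal h).trans_eq ?_
  rw [mul_comm, ENNReal.ofReal_mul (by positivity), ENNReal.ofReal_pow (by norm_num), mul_comm]
  norm_num

lemma HasExpMoments.integrable_mul {m : Measure X} {H v : Multiset X → ℝ}
    (hm : JointlyMeasurable fun _ : PUnit.{u + 1} => H)
    (hv : JointlyMeasurable fun _ : PUnit.{u + 1} => v)
    (hH : HasExpMoments m fun M => ‖H M‖ₑ) {C : ℝ} {q : ℕ}
    (hC : ∀ M, |v M| ≤ C * 2 ^ (q * M.card)) :
    Integrable (fun s => H (points s.2) * v (points s.2)) (poissonSample m) := by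
  refine ⟨((hm.measurable_right PUnit.unit).mul
    (hv.measurable_right PUnit.unit)).aestronglyMeasurable, ?_⟩
  rw [hasFiniteIntegral_iff_enorm]
  refine lt_of_le_of_lt (b := ∫⁻ s, ENNReal.ofReal C * (‖H (points s.2)‖ₑ * 2 ^ (q * s.1))
    ∂poissonSample m) (lintegral_mono fun s => ?_) ?_
  · rw [enorm_mul]
    have := enorm_le_ofReal_mul (hC (points s.2))
    rw [card_points, Fintype.card_fin] at this
    calc _ ≤ ‖H (points s.2)‖ₑ * (ENNReal.ofReal C * 2 ^ (q * s.1)) := by gcongr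
      _ = _ := by ring
  · rw [lintegral_const_mul' _ _ (by finiteness)]
    exact ENNReal.mul_lt_top (by finiteness) (hH q).lt_top

lemma integrable_prod_of_bound {m : Measure X} [IsFiniteMeasure m] {H v : X → Multiset X → ℝ}
    (hm : JointlyMeasurable H) (hv : JointlyMeasurable v) {C : ℝ} {q : ℕ}
    (hH : ∫⁻ z, ∫⁻ s, ‖H z (points s.2)‖ₑ * 2 ^ (q * s.1) ∂poissonSample m ∂m ≠ ∞)
    (hC : ∀ z M, |v z M| ≤ C * 2 ^ (q * M.card)) :
    Integrable (fun p : X × (Σ n, Fin n → X) => H p.1 (points p.2.2) * v p.1 (points p.2.2))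
      (m.prod (poissonSample m)) := by
  have hmeas : Measurable fun p : X × (Σ n, Fin n → X) =>
      H p.1 (points p.2.2) * v p.1 (points p.2.2) :=
    hm.measurable_prod.mul hv.measurable_prod
  refine ⟨hmeas.aestronglyMeasurable, ?_⟩
  rw [hasFiniteIntegral_iff_enorm, lintegral_prod _ hmeas.enorm.aemeasurable]
  refine lt_of_le_of_lt (b := ∫⁻ z, ENNReal.ofReal C * ∫⁻ s, ‖H z (points s.2)‖ₑ * 2 ^ (q * s.1)
    ∂poissonSample m ∂m) (lintegral_mono fun z => ?_) ?_
  · rw [← lintegral_const_mul' _ _ (by finiteness)]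
    refine lintegral_mono fun s => ?_
    rw [enorm_mul]
    have := enorm_le_ofReal_mul (hC z (points s.2))
    rw [card_points, Fintype.card_fin] at this
    calc _ ≤ ‖H z (points s.2)‖ₑ * (ENNReal.ofReal C * 2 ^ (q * s.1)) := by gcongr
      _ = _ := by ring
  · rw [lintegral_const_mul' _ _ (by finiteness)]
    exact ENNReal.mul_lt_top (by finiteness) hH.lt_top

/-- One step of the duality between the add-one-cost operator and the Skorohod integral
`δ(v)`: it is the Mecke equation applied to `(z, M) ↦ H(M + δ_z) v(z, M)`. -/
lemma integral_mul_skorohod (m : Measure X) [IsFiniteMeasure m] {H : Multiset X → ℝ}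
    (hm : JointlyMeasurable fun _ : PUnit.{u + 1} => H)
    (hH : HasExpMoments m fun M => ‖H M‖ₑ) {v : X → Multiset X → ℝ} (hv : JointlyMeasurable v)
    {C : ℝ} {q : ℕ} (hC : ∀ z M, |v z M| ≤ C * 2 ^ (q * M.card)) :
    ∫ s, H (points s.2) * (removeSum v (points s.2) - ∫ z, v z (points s.2) ∂m) ∂poissonSample m
      = ∫ z, ∫ s, addOneCost z H (points s.2) * v z (points s.2) ∂poissonSample m ∂m := by
  have ha : JointlyMeasurable fun (_ : PUnit.{u + 1}) M => ‖H M‖ₑ := fun k => (hm k).enorm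
  have i1 := integrable_prod_of_bound (m := m) (hm.cons_left) hv (C := C) (q := q)
    (ne_top_of_le_ne_top (hH (q + 1)) (lintegral_cons_le m ha q)) hC
  have i2 := integrable_prod_of_bound (m := m) (hm.const_left (A := X)) hv (C := C) (q := q)
    (by rw [lintegral_const]; exact ENNReal.mul_ne_top (hH q) (by finiteness)) hC
  obtain ⟨i3, e3⟩ := integral_removeSum m
    (v := fun z M => H (z ::ₘ M) * v z M) (fun k => (hm.cons_left k).mul (hv k)) i1
  simp only [← mul_removeSum] at i3 e3
  have hc (s : Σ n, Fin n → X) : ∫ z, H (points s.2) * v z (points s.2) ∂m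
      = H (points s.2) * ∫ z, v z (points s.2) ∂m := integral_const_mul _ _
  have e4 := integral_prod_symm _ i2
  have i4 := i2.integral_prod_right
  simp only [hc] at e4 i4
  simp only [mul_sub]
  rw [integral_sub i3 i4, e3, ← e4, ← integral_sub i1 i2]
  refine (integral_prod _ (i1.sub i2)).trans ?_
  simp only [Pi.sub_apply, addOneCost, sub_mul]

/-- The duality `E[H(ζ) Iₙ(g)(ζ)] = ∫ g(y) E[D_y H(ζ)] dmⁿ(y)` for a Poisson sample `ζ`. -/
theorem integral_mul_wienerIto (m : Measure X) [IsFiniteMeasure m] (n : ℕ) {H : Multiset X → ℝ}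
    (hm : JointlyMeasurable fun _ : PUnit.{u + 1} => H)
    (hH : HasExpMoments m fun M => ‖H M‖ₑ) {g : Multiset X → ℝ}
    (hg : JointlyMeasurable fun _ : PUnit.{u + 1} => g) {C : ℝ} (hC : ∀ M, |g M| ≤ C) :
    ∫ s, H (points s.2) * wienerIto m n g (points s.2) ∂poissonSample m
      = ∫ y : Fin n → X, g (points y) * ∫ s, iterCost (points y) H (points s.2) ∂poissonSample m
        ∂Measure.pi (fun _ => m) := by
  induction n generalizing H g with
  | zero =>
    have h0 (x : Fin 0 → X) : points x = 0 := by simp [points]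
    simp [h0, wienerIto, iterCost_zero, integral_mul_const, mul_comm, Measure.real]
  | succ n ih =>
    have hK (z : X) (M : Multiset X) := abs_wienerIto_le m n (g := fun N => g (z ::ₘ N))
      (fun M => hC _) M
    have h1 := integral_mul_skorohod m hm hH (hg.cons_left.wienerIto m n) hK
    have hD (z : X) : JointlyMeasurable fun (_ : PUnit.{u + 1}) M => addOneCost z H M :=
      fun k => (hm.cons_left.comp (κ := fun _ : PUnit.{u + 1} => z) measurable_const k).sub (hm k)
    have h2 : ∀ᵐ z ∂m, ∫ s, addOneCost z H (points s.2) *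
          wienerIto m n (fun N => g (z ::ₘ N)) (points s.2) ∂poissonSample m
        = ∫ y : Fin n → X, g (z ::ₘ points y) * ∫ s, iterCost (z ::ₘ points y) H (points s.2)
          ∂poissonSample m ∂Measure.pi (fun _ => m) := by
      filter_upwards [hH.ae_addOneCost hm] with z hz
      simp only [iterCost_cons]
      exact ih (hD z) hz (hg.cons_left.comp (κ := fun _ : PUnit.{u + 1} => z) measurable_const)
        fun M => hC _
    simp only [wienerIto]
    rw [h1, integral_congr_ae h2, integral_pi_cons]
    · simp only [points_cons]
    · have hJ := (hm.iterCost (n + 1)).comp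
        (κ := fun y : Fin (n + 1) → X => (PUnit.unit.{u + 1}, y)) (by fun_prop)
      have hmeas : Measurable fun y : Fin (n + 1) → X =>
          g (points y) * ∫ s, iterCost (points y) H (points s.2) ∂poissonSample m :=
        ((hg (n + 1)).comp (by fun_prop : Measurable fun y : Fin (n + 1) → X =>
          (PUnit.unit.{u + 1}, y))).mul
          hJ.measurable_prod.stronglyMeasurable.integral_prod_right.measurable
      refine ⟨hmeas.aestronglyMeasurable, ?_⟩
      rw [hasFiniteIntegral_iff_enorm]
      have ha : JointlyMeasurable fun (_ : PUnit.{u + 1}) M => ‖H M‖ₑ := fun k => (hm k).enorm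
      refine lt_of_le_of_lt (b := ∫⁻ y : Fin (n + 1) → X, ENNReal.ofReal C * ∫⁻ s,
        subsetSum (points y) (fun M => ‖H M‖ₑ) (points s.2) * 2 ^ (0 * s.1) ∂poissonSample m
          ∂Measure.pi (fun _ => m)) (lintegral_mono fun y => ?_) ?_
      · rw [enorm_mul]
        gcongr
        · have := enorm_le_ofReal_mul (x := g (points y)) (C := C) (j := 0) (by simpa using hC _)
          simpa using this
        · refine (enorm_integral_le_lintegral_enorm _).trans (lintegral_mono fun s => ?_)
          simpa using enorm_iterCost_le (points y) H (points s.2)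
      · rw [lintegral_const_mul' _ _ (by finiteness)]
        refine ENNReal.mul_lt_top (by finiteness)
          ((lintegral_subsetSum_le m (n + 1) ha 0).trans_lt ?_)
        exact ENNReal.mul_lt_top (by finiteness) (hH _).lt_top

lemma hasExpMoments_of_bound (m : Measure X) [IsFiniteMeasure m] {H : Multiset X → ℝ} {C : ℝ}
    {q : ℕ} (hC : ∀ M, |H M| ≤ C * 2 ^ (q * M.card)) : HasExpMoments m fun M => ‖H M‖ₑ := by
  intro p
  have h2 := lintegral_pow_poissonSample m (t := 2 ^ (q + p)) (by positivity)
  have e : ENNReal.ofReal (2 ^ (q + p)) = 2 ^ (q + p) := by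
    rw [ENNReal.ofReal_pow (by norm_num)]
    norm_num
  rw [e] at h2
  refine ne_top_of_le_ne_top (b := ∫⁻ s, ENNReal.ofReal C * (2 ^ (q + p)) ^ s.1 ∂poissonSample m)
    ?_ (lintegral_mono fun s => ?_)
  · rw [lintegral_const_mul' _ _ (by finiteness), h2]
    finiteness
  · have := enorm_le_ofReal_mul (hC (points s.2))
    rw [card_points, Fintype.card_fin] at this
    calc _ ≤ ENNReal.ofReal C * 2 ^ (q * s.1) * 2 ^ (p * s.1) := by gcongr
      _ = _ := by rw [← pow_mul, mul_assoc, ← pow_add, add_mul]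

lemma JointlyMeasurable.wienerIto_unit (m : Measure X) [SFinite m] (n : ℕ) {g : Multiset X → ℝ}
    (hg : JointlyMeasurable fun _ : PUnit.{u + 1} => g) :
    JointlyMeasurable fun _ : PUnit.{u + 1} => _root_.wienerIto m n g :=
  JointlyMeasurable.wienerIto m n hg

/-- The isometry `E[Iₙ(g)²] = n! ∫ g² dmⁿ`. -/
theorem integral_wienerIto_sq (m : Measure X) [IsFiniteMeasure m] (n : ℕ) {g : Multiset X → ℝ}
    (hg : JointlyMeasurable fun _ : PUnit.{u + 1} => g) {C : ℝ} (hC : ∀ M, |g M| ≤ C) :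
    ∫ s, wienerIto m n g (points s.2) ^ 2 ∂poissonSample m
      = n ! * ∫ y : Fin n → X, g (points y) ^ 2 ∂Measure.pi (fun _ => m) := by
  simp only [sq]
  rw [integral_mul_wienerIto m n (hg.wienerIto_unit m n)
    (hasExpMoments_of_bound m (abs_wienerIto_le m n hC)) hg hC, ← integral_const_mul]
  congr 1 with y
  simp only [iterCost_wienerIto m hg hC
    (show (points y).card = n by simp [card_points])]
  simp
  ring

lemma integral_wienerIto (m : Measure X) [IsFiniteMeasure m] {n : ℕ} (hn : n ≠ 0)
    {g : Multiset X → ℝ} (hg : JointlyMeasurable fun _ : PUnit.{u + 1} => g) {C : ℝ}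
    (hC : ∀ M, |g M| ≤ C) :
    ∫ s, wienerIto m n g (points s.2) ∂poissonSample m = 0 := by
  have h := integral_mul_wienerIto m n (H := fun _ => (1 : ℝ)) (fun k => measurable_const)
    (hasExpMoments_of_bound m (C := 1) (q := 0) (by simp)) hg hC
  have h0 (y : Fin n → X) : points y ≠ 0 := by
    rw [← Multiset.card_pos, card_points, Fintype.card_fin]
    omega
  simpa [iterCost_const _ (h0 _)] using h

end Duality

/-! ### Restriction of configurations and addition of points -/

section Configurations

variable {X : Type*} [MeasurableSpace X]

lemma Configuration.measurable_apply {B : Set X} (hB : MeasurableSet B) :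
    Measurable fun μ : Configuration X => μ.1 B :=
  (Measure.measurable_coe hB).comp measurable_subtype_coe

lemma Configuration.measurable_of_apply {A : Type*} [MeasurableSpace A] {κ : A → Configuration X}
    (h : ∀ B, MeasurableSet B → Measurable fun a => (κ a).1 B) : Measurable κ :=
  (Measure.measurable_of_measurable_coe (fun a => (κ a).1) h).subtype_mk

/-- The restriction of a configuration to a measurable set. -/
noncomputable def Configuration.restrict (μ : Configuration X) {B : Set X}
    (hB : MeasurableSet B) : Configuration X :=
  ⟨μ.1.restrict B,
    haveI := μ.2.1
    ⟨inferInstance, fun A hA => by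
      rw [Measure.restrict_apply hA]
      exact μ.2.2 _ (hA.inter hB)⟩⟩

lemma Configuration.restrict_val (μ : Configuration X) {B : Set X} (hB : MeasurableSet B) :
    (μ.restrict hB).1 = μ.1.restrict B := rfl

/-- The configuration `μ + ∑_{z ∈ M} δ_z`, for a finite multiset `M` of points. -/
noncomputable def Configuration.addMultiset (μ : Configuration X) (M : Multiset X) :
    Configuration X :=
  μ.addPoints Finset.univ fun i : Fin M.toList.length => M.toList.get i

lemma Configuration.addMultiset_val (μ : Configuration X) (M : Multiset X) :
    (μ.addMultiset M).1 = μ.1 + (M.map Measure.dirac).sum := by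
  have h : (points fun i : Fin M.toList.length => M.toList.get i) = M :=
    (points_get _).trans M.coe_toList
  conv_rhs => rw [← h, points, Multiset.map_map]
  rfl

lemma Configuration.addPoints_eq {ι : Type*} (μ : Configuration X) (I : Finset ι) (x : ι → X) :
    μ.addPoints I x = μ.addMultiset (I.val.map x) := by
  apply Subtype.ext
  rw [addMultiset_val, Multiset.map_map]
  rfl

lemma Configuration.addMultiset_add (μ : Configuration X) (M N : Multiset X) :
    μ.addMultiset (M + N) = (μ.addMultiset N).addMultiset M := by
  apply Subtype.ext
  simp only [addMultiset_val, Multiset.map_add, Multiset.sum_add]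
  rw [add_assoc, add_comm (Multiset.sum _)]

lemma Configuration.addMultiset_points_val (μ : Configuration X) {ι : Type*} [Fintype ι]
    (x : ι → X) : (μ.addMultiset (points x)).1 = μ.1 + ∑ i, Measure.dirac (x i) := by
  rw [addMultiset_val, points, Multiset.map_map]
  rfl

lemma Configuration.measurable_addMultiset_points {A ι : Type*} [MeasurableSpace A] [Fintype ι]
    {κ : A → Configuration X} (hκ : Measurable κ) {x : A → ι → X} (hx : Measurable x) :
    Measurable fun a => (κ a).addMultiset (points (x a)) := by
  refine measurable_of_apply fun B hB => ?_
  simp only [addMultiset_points_val, Measure.add_apply, Measure.finsetSum_apply,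
    Measure.dirac_apply' _ hB]
  refine ((measurable_apply hB).comp hκ).add (Finset.measurable_fun_sum _ fun i _ => ?_)
  exact (measurable_one.indicator hB).comp ((measurable_pi_apply i).comp hx)

lemma Configuration.measurable_addMultiset_sample {A : Type*} [MeasurableSpace A]
    {κ : A → Configuration X} (hκ : Measurable κ) :
    Measurable fun p : A × (Σ n, Fin n → X) => (κ p.1).addMultiset (points p.2.2) := by
  refine measurable_prod_sigma fun n => ?_
  have h1 : Measurable fun p : A × (Fin n → X) => κ p.1 := hκ.comp measurable_fst
  change Measurable fun p : A × (Fin n → X) => (κ p.1).addMultiset (points p.2)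
  exact measurable_addMultiset_points h1 measurable_snd

lemma Configuration.measurable_restrict {B : Set X} (hB : MeasurableSet B) :
    Measurable fun μ : Configuration X => μ.restrict hB := by
  refine measurable_of_apply fun A hA => ?_
  simp only [restrict_val, Measure.restrict_apply hA]
  exact measurable_apply (hA.inter hB)

end Configurations

/-! ### Characteristic functionals -/

section CharacteristicFunctional

universe u

variable {X : Type u} {Ω : Type*} [MeasurableSpace X] [MeasurableSpace Ω] {ν : Measure X}
  {P : Measure Ω} [IsProbabilityMeasure P] {η : Ω → Configuration X}

omit [IsProbabilityMeasure P] in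
lemma IsPoissonProcess.measurable_apply (hη : IsPoissonProcess η ν P) {B : Set X}
    (hB : MeasurableSet B) : Measurable fun ω => (η ω).1 B :=
  (Configuration.measurable_apply hB).comp hη.measurable

omit [IsProbabilityMeasure P] in
lemma IsPoissonProcess.ae_lt_top (hη : IsPoissonProcess η ν P) {B : Set X}
    (hB : MeasurableSet B) (hfin : ν B < ∞) : ∀ᵐ ω ∂P, (η ω).1 B < ∞ := by
  have h : ∀ᵐ t ∂(P.map fun ω => (η ω).1 B), t < ∞ := by
    rw [hη.law B hB, poissonLaw, if_neg hfin.ne,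
      ae_map_iff (Measurable.of_discrete).aemeasurable measurableSet_Iio]
    exact Filter.Eventually.of_forall fun n => by simp
  exact ae_of_ae_map (hη.measurable_apply hB).aemeasurable h

lemma IsPoissonProcess.integral_exp_apply (hη : IsPoissonProcess η ν P) {B : Set X}
    (hB : MeasurableSet B) {t : ℝ} (hfin : ν B < ∞ ∨ t = 0) :
    ∫ ω, Complex.exp (((η ω).1 B).toReal * t * Complex.I) ∂P
      = Complex.exp (ν.real B * (Complex.exp (t * Complex.I) - 1)) := by
  rcases hfin with hfin | rfl
  · have hm : Measurable fun a : ℝ≥0∞ => Complex.exp (a.toReal * t * Complex.I) := by fun_prop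
    have e : ∫ ω, Complex.exp (((η ω).1 B).toReal * t * Complex.I) ∂P
        = ∫ a, Complex.exp (a.toReal * t * Complex.I) ∂(P.map fun ω => (η ω).1 B) :=
      (integral_map (hη.measurable_apply hB).aemeasurable hm.aestronglyMeasurable).symm
    rw [e, hη.law B hB, poissonLaw, if_neg hfin.ne,
      integral_map Measurable.of_discrete.aemeasurable hm.aestronglyMeasurable]
    have h := charFun_map_cast_poissonMeasure (ν B).toNNReal t
    rw [charFun_apply_real, integral_map .of_discrete (by fun_prop)] at h
    simp only [ENNReal.toReal_natCast, Measure.real]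
    rw [show ((ν B).toReal : ℂ) = (((ν B).toNNReal : ℝ) : ℂ) from rfl, ← h]
    congr 1 with n
    push_cast
    ring_nf
  · simp

lemma integrable_exp_sub_one {g : SimpleFunc X ℝ} (hg : g.FinMeasSupp ν) :
    Integrable (fun x => Complex.exp (g x * Complex.I) - 1) ν :=
  (hg.map (g := fun y : ℝ => Complex.exp (y * Complex.I) - 1) (by simp)).integrable

/-- The characteristic functional of a Poisson process at a simple function `g`. The level sets
of `g` are disjoint, so the counts in them are independent Poisson variables. -/
lemma IsPoissonProcess.integral_exp_integral (hη : IsPoissonProcess η ν P)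
    {g : SimpleFunc X ℝ} (hg : g.FinMeasSupp ν) :
    ∫ ω, Complex.exp ((∫ x, g x ∂(η ω).1 : ℝ) * Complex.I) ∂P
      = Complex.exp (∫ x, (Complex.exp (g x * Complex.I) - 1) ∂ν) := by
  obtain ⟨n, ⟨e⟩⟩ : ∃ n, Nonempty (Fin n ≃ g.range) := ⟨_, ⟨g.range.equivFin.symm⟩⟩
  set B : Fin n → Set X := fun i => g ⁻¹' {(e i : ℝ)} with hBdef
  have hB (i) : MeasurableSet (B i) := g.measurableSet_preimage _
  have hdisj : Pairwise fun i j => Disjoint (B i) (B j) := by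
    intro i j hij
    refine Disjoint.preimage _ (Set.disjoint_singleton.2 fun h => hij ?_)
    exact e.injective (Subtype.ext h)
  have hsum {E : Type} [AddCommMonoid E] (F : ℝ → E) :
      ∑ y ∈ g.range, F y = ∑ i, F (e i) := by
    rw [← Finset.sum_coe_sort]
    exact (Equiv.sum_comp e fun y => F y).symm
  have hae : ∀ᵐ ω ∂P, Complex.exp ((∫ x, g x ∂(η ω).1 : ℝ) * Complex.I)
      = ∏ i, Complex.exp (((η ω).1 (B i)).toReal * (e i : ℝ) * Complex.I) := by
    filter_upwards [hη.ae_lt_top g.measurableSet_support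
      (SimpleFunc.finMeasSupp_iff_support.1 hg)] with ω hω
    rw [← g.integral_eq_integral (SimpleFunc.finMeasSupp_iff_support.2 hω).integrable,
      g.integral_eq, hsum, ← Complex.exp_sum]
    congr 1
    simp only [smul_eq_mul, Measure.real]
    push_cast
    rw [Finset.sum_mul]
  have hmeas (i) : Measurable fun t : ℝ≥0∞ =>
      Complex.exp (t.toReal * (e i : ℝ) * Complex.I) := by fun_prop
  have hprod := iIndepFun.integral_fun_prod_comp (X := fun i ω => (η ω).1 (B i))
    (f := fun i t => Complex.exp (t.toReal * (e i : ℝ) * Complex.I))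
    (hη.indep n B hB hdisj) (fun i => (hη.measurable_apply (hB i)).aemeasurable)
    (fun i => (hmeas i).aestronglyMeasurable)
  rw [integral_congr_ae hae, hprod]
  have hfin (i) : ν (B i) < ∞ ∨ (e i : ℝ) = 0 := by
    by_cases h : (e i : ℝ) = 0
    · exact Or.inr h
    · exact Or.inl (SimpleFunc.finMeasSupp_iff.1 hg _ h)
  simp only [hη.integral_exp_apply (hB _) (hfin _)]
  rw [← Complex.exp_sum]
  congr 1
  have h1 := SimpleFunc.integral_eq_integral
    (g.map fun y : ℝ => Complex.exp (y * Complex.I) - 1) (integrable_exp_sub_one hg)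
  rw [SimpleFunc.map_integral _ _ hg.integrable (by simp), hsum] at h1
  simp only [Complex.real_smul] at h1
  exact h1

/-- The characteristic functional of a Poisson sample. -/
lemma integral_exp_poissonSample (m : Measure X) [IsFiniteMeasure m] {g : X → ℝ}
    (hg : Measurable g) :
    ∫ s, Complex.exp ((∑ i, g (s.2 i) : ℝ) * Complex.I) ∂poissonSample m
      = Complex.exp (∫ x, (Complex.exp (g x * Complex.I) - 1) ∂m) := by
  have hnorm (t : ℝ) : ‖Complex.exp (t * Complex.I)‖ = 1 := Complex.norm_exp_ofReal_mul_I t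
  have hmeas : Measurable fun s : Σ n, Fin n → X =>
      Complex.exp ((∑ i, g (s.2 i) : ℝ) * Complex.I) := by
    have : Measurable fun p : PUnit.{u + 1} × Σ n, Fin n → X =>
        Complex.exp ((∑ i, g (p.2.2 i) : ℝ) * Complex.I) :=
      measurable_prod_sigma fun n => by
        change Measurable fun p : PUnit.{u + 1} × (Fin n → X) =>
          Complex.exp ((∑ i, g (p.2 i) : ℝ) * Complex.I)
        fun_prop
    exact this.comp (measurable_prodMk_left (x := PUnit.unit.{u + 1}))
  have hint : Integrable (fun s : Σ n, Fin n → X =>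
      Complex.exp ((∑ i, g (s.2 i) : ℝ) * Complex.I)) (poissonSample m) :=
    Integrable.of_bound hmeas.aestronglyMeasurable 1
      (Filter.Eventually.of_forall fun s => (hnorm _).le)
  have hint1 : Integrable (fun x => Complex.exp (g x * Complex.I)) m :=
    Integrable.of_bound (by fun_prop : Measurable fun x =>
      Complex.exp (g x * Complex.I)).aestronglyMeasurable 1
      (Filter.Eventually.of_forall fun x => (hnorm _).le)
  set w := ∫ x, Complex.exp (g x * Complex.I) ∂m with hw
  set b := m.real Set.univ with hb
  have hterm (n : ℕ) : ∫ s, Complex.exp ((∑ i, g (s.2 i) : ℝ) * Complex.I)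
      ∂(ENNReal.ofReal (Real.exp (-b) / n !) •
        (Measure.pi fun _ : Fin n => m).map (Sigma.mk (β := fun n => Fin n → X) n))
      = Complex.exp (-b) * (w ^ n / n !) := by
    rw [integral_smul_measure, (measurableEmbedding_sigmaMk n).integral_map,
      ENNReal.toReal_ofReal (by positivity)]
    have : (fun x : Fin n → X => Complex.exp ((∑ i, g (x i) : ℝ) * Complex.I))
        = fun x => ∏ i, Complex.exp (g (x i) * Complex.I) := by
      funext x
      rw [← Complex.exp_sum]
      push_cast
      rw [Finset.sum_mul]
    rw [this, integral_fintype_prod_eq_prod (fun _ x => Complex.exp (g x * Complex.I))]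
    simp only [Finset.prod_const, Finset.card_univ, Fintype.card_fin, Complex.real_smul, ← hw]
    push_cast
    ring
  have h1 := (hasSum_integral_measure (μ := fun n => ENNReal.ofReal (Real.exp (-b) / n !) •
        (Measure.pi fun _ : Fin n => m).map (Sigma.mk (β := fun n => Fin n → X) n)) hint).tsum_eq
  simp only [hterm] at h1
  have h2 := NormedSpace.expSeries_div_hasSum_exp (𝔸 := ℂ) w
  rw [← Complex.exp_eq_exp_ℂ] at h2
  rw [tsum_mul_left, h2.tsum_eq, ← Complex.exp_add] at h1
  change _ = ∫ s, Complex.exp ((∑ i, g (s.2 i) : ℝ) * Complex.I) ∂poissonSample m at h1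
  rw [← h1, integral_sub hint1 (integrable_const _), integral_const, ← hw, ← hb]
  congr 1
  simp
  ring

lemma exists_simpleFunc_eq_sum {ι : Type*} (t : Finset ι) {A : ι → Set X}
    (hA : ∀ i ∈ t, MeasurableSet (A i)) (hfin : ∀ i ∈ t, ν (A i) < ∞) (c : ι → ℝ) :
    ∃ g : SimpleFunc X ℝ, g.FinMeasSupp ν ∧
      ∀ x, g x = ∑ i ∈ t, (A i).indicator (fun _ => c i) x := by
  classical
  induction t using Finset.induction_on with
  | empty => exact ⟨0, by simp [SimpleFunc.finMeasSupp_iff_support], by simp⟩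
  | insert a s ha ih =>
    obtain ⟨g, hg, hg'⟩ := ih (fun i hi => hA i (Finset.mem_insert_of_mem hi))
      fun i hi => hfin i (Finset.mem_insert_of_mem hi)
    have hAa := hA a (Finset.mem_insert_self _ _)
    refine ⟨(SimpleFunc.const X (c a)).restrict (A a) + g, ?_, fun x => ?_⟩
    · refine SimpleFunc.FinMeasSupp.add ?_ hg
      rw [SimpleFunc.finMeasSupp_iff_support, SimpleFunc.coe_restrict _ hAa]
      exact (measure_mono Set.support_indicator_subset).trans_lt
        (hfin a (Finset.mem_insert_self _ _))
    · rw [Finset.sum_insert ha, SimpleFunc.coe_add, Pi.add_apply, hg',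
        SimpleFunc.coe_restrict _ hAa]
      rfl

/-- The counts in sets of finite `ν`-measure already generate the σ-field on configurations. -/
lemma iSup_comap_apply_eq (ν : Measure X) [SigmaFinite ν] :
    (⨆ A ∈ (Set.univ : Set {A : Set X // MeasurableSet A ∧ ν A < ∞}),
      MeasurableSpace.comap (fun μ : Configuration X => μ.1 A.1) inferInstance)
      = (inferInstance : MeasurableSpace (Configuration X)) := by
  apply le_antisymm
  · refine iSup₂_le fun A _ => ?_
    exact (Configuration.measurable_apply A.2.1).comap_le
  · set 𝓖 := ⨆ A ∈ (Set.univ : Set {A : Set X // MeasurableSet A ∧ ν A < ∞}),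
      MeasurableSpace.comap (fun μ : Configuration X => μ.1 A.1) inferInstance with h𝓖
    have h1 (A : Set X) (hA : MeasurableSet A) (hfin : ν A < ∞) :
        Measurable[𝓖] fun μ : Configuration X => μ.1 A := by
      refine Measurable.of_comap_le ?_
      rw [h𝓖]
      exact le_iSup₂_of_le (⟨A, hA, hfin⟩ : {A : Set X // MeasurableSet A ∧ ν A < ∞})
        (Set.mem_univ _) le_rfl
    have h2 (A : Set X) (hA : MeasurableSet A) :
        Measurable[𝓖] fun μ : Configuration X => μ.1 A := by
      have e : (fun μ : Configuration X => μ.1 A)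
          = fun μ => ⨆ j, μ.1 (A ∩ spanningSets ν j) := by
        funext μ
        rw [← Monotone.measure_iUnion, ← Set.inter_iUnion, iUnion_spanningSets, Set.inter_univ]
        exact fun i j hij => Set.inter_subset_inter_right _ (spanningSets_mono hij)
      rw [e]
      exact Measurable.iSup fun j => h1 _ (hA.inter (measurableSet_spanningSets ν j))
        ((measure_mono Set.inter_subset_right).trans_lt (measure_spanningSets_lt_top ν j))
    have h3 : Measurable[𝓖] fun μ : Configuration X => μ.1 :=
      Measure.measurable_of_measurable_coe _ h2
    exact h3.comap_le

/-- A probability measure on configurations is determined by its characteristic functional at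
simple functions, if the configurations are locally finite with respect to `ν`. -/
theorem ext_of_integral_exp [SigmaFinite ν] {Q Q' : Measure (Configuration X)}
    [IsProbabilityMeasure Q] [IsProbabilityMeasure Q']
    (hQ : ∀ A, MeasurableSet A → ν A < ∞ → ∀ᵐ μ ∂Q, μ.1 A < ∞)
    (hQ' : ∀ A, MeasurableSet A → ν A < ∞ → ∀ᵐ μ ∂Q', μ.1 A < ∞)
    (h : ∀ g : SimpleFunc X ℝ, g.FinMeasSupp ν →
      ∫ μ, Complex.exp ((∫ x, g x ∂μ.1 : ℝ) * Complex.I) ∂Q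
        = ∫ μ, Complex.exp ((∫ x, g x ∂μ.1 : ℝ) * Complex.I) ∂Q') : Q = Q' := by
  classical
  refine ext_of_generate_finite _
    ((iSup_comap_apply_eq ν).symm.trans
      (generateFrom_piiUnionInter_measurableSet _ _).symm)
    (isPiSystem_piiUnionInter _
      (fun A : {A : Set X // MeasurableSet A ∧ ν A < ∞} =>
        @MeasurableSpace.isPiSystem_measurableSet _
        (MeasurableSpace.comap (fun μ : Configuration X => μ.1 A.1) inferInstance)) _) ?_
    (by simp)
  rintro _ ⟨t, -, f, hf, rfl⟩
  choose! E hE hEf using hf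
  -- The counts in the sets of `t` are almost surely finite, so that their joint law is determined
  -- by that of their finite values, a measure on `ℝᵗ`.
  set V : Configuration X → (t → ℝ) := fun μ A => (μ.1 A.1.1).toReal with hV
  have hVm : Measurable V := measurable_pi_iff.2 fun A =>
    (Configuration.measurable_apply A.1.2.1).ennreal_toReal
  have hfinsum (S : Measure (Configuration X))
      (hS : ∀ A, MeasurableSet A → ν A < ∞ → ∀ᵐ μ ∂S, μ.1 A < ∞) :
      ∀ᵐ μ ∂S, ∀ A : t, μ.1 A.1.1 < ∞ :=
    ae_all_iff.2 fun A => hS _ A.1.2.1 A.1.2.2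
  have hmap : Q.map V = Q'.map V := by
    have := Measure.isProbabilityMeasure_map (μ := Q) hVm.aemeasurable
    have := Measure.isProbabilityMeasure_map (μ := Q') hVm.aemeasurable
    refine Measure.ext_of_charFunDual (funext fun L => ?_)
    obtain ⟨g, hg, hg'⟩ := exists_simpleFunc_eq_sum (ν := ν) (Finset.univ : Finset {A // A ∈ t})
      (A := fun A : {A // A ∈ t} => A.1.1) (fun A _ => A.1.2.1) (fun A _ => A.1.2.2)
      (fun A => L (Pi.single A 1))
    have key (S : Measure (Configuration X))
        (hS : ∀ A, MeasurableSet A → ν A < ∞ → ∀ᵐ μ ∂S, μ.1 A < ∞) :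
        charFunDual (S.map V) L
          = ∫ μ, Complex.exp ((∫ x, g x ∂μ.1 : ℝ) * Complex.I) ∂S := by
      rw [charFunDual_apply, integral_map hVm.aemeasurable (by fun_prop)]
      refine integral_congr_ae ?_
      filter_upwards [hfinsum S hS] with μ hμ
      congr 3
      simp only [hg']
      rw [integral_finsetSum]
      · have hL : L (V μ) = ∑ A, V μ A * L (Pi.single A 1) := by
          conv_lhs => rw [pi_eq_sum_univ' (V μ)]
          simp [map_sum]
        rw [hL]
        refine Finset.sum_congr rfl fun A _ => ?_
        rw [integral_indicator A.1.2.1, setIntegral_const]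
        rfl
      · intro A _
        exact (integrable_indicator_iff A.1.2.1).2 (integrableOn_const (hμ A).ne)
    rw [key Q hQ, key Q' hQ', h g hg]
  have hset (S : Measure (Configuration X))
      (hS : ∀ A, MeasurableSet A → ν A < ∞ → ∀ᵐ μ ∂S, μ.1 A < ∞) :
      S (⋂ A ∈ t, f A) = S.map V {v | ∀ A : t, ENNReal.ofReal (v A) ∈ E A.1} := by
    rw [Measure.map_apply hVm]
    · refine measure_congr ?_
      filter_upwards [hfinsum S hS] with μ hμ
      apply propext
      change μ ∈ (⋂ A ∈ t, f A) ↔ ∀ A : t, ENNReal.ofReal (V μ A) ∈ E A.1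
      have hA (A) (hA : A ∈ t) : μ ∈ f A ↔ ENNReal.ofReal (V μ ⟨A, hA⟩) ∈ E A := by
        rw [← hEf A hA, hV, ENNReal.ofReal_toReal (hμ ⟨A, hA⟩).ne]
        rfl
      simp only [Set.mem_iInter]
      exact ⟨fun h A => (hA A.1 A.2).1 (h A.1 A.2), fun h A hAt => (hA A hAt).2 (h ⟨A, hAt⟩)⟩
    · rw [Set.ofPred_forall]
      exact MeasurableSet.iInter fun A =>
        (ENNReal.measurable_ofReal.comp (measurable_pi_apply A)) (hE A.1 A.2)
  rw [hset Q hQ, hset Q' hQ', hmap]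

lemma aestronglyMeasurable_exp_integral {Q : Measure (Configuration X)} {g : SimpleFunc X ℝ}
    (h : ∀ᵐ μ ∂Q, μ.1 (Function.support g) < ∞) :
    AEStronglyMeasurable (fun μ : Configuration X =>
      Complex.exp ((∫ x, g x ∂μ.1 : ℝ) * Complex.I)) Q := by
  have hm : Measurable fun μ : Configuration X =>
      Complex.exp ((∑ y ∈ g.range, (μ.1 (g ⁻¹' {y})).toReal * y : ℝ) * Complex.I) := by
    have h1 (y : ℝ) : Measurable fun μ : Configuration X => (μ.1 (g ⁻¹' {y})).toReal :=
      (Configuration.measurable_apply (g.measurableSet_preimage _)).ennreal_toReal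
    fun_prop
  refine hm.aestronglyMeasurable.congr ?_
  filter_upwards [h] with μ hμ
  rw [← g.integral_eq_integral (SimpleFunc.finMeasSupp_iff_support.2 hμ).integrable,
    g.integral_eq]
  rfl

/-- The independence of a Poisson process in a set `B` of finite intensity and outside of it: the
law of `η` does not change if its restriction to `B` is replaced by an independent Poisson
sample. -/
theorem IsPoissonProcess.map_eq_map_addMultiset [SigmaFinite ν] (hη : IsPoissonProcess η ν P)
    {B : Set X} (hB : MeasurableSet B) [IsFiniteMeasure (ν.restrict B)] :
    P.map η = ((poissonSample (ν.restrict B)).prod P).map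
      fun p => ((η p.2).restrict hB.compl).addMultiset (points p.1.2) := by
  set ρ := poissonSample (ν.restrict B) with hρ
  set κ : (Σ n, Fin n → X) × Ω → Configuration X :=
    fun p => ((η p.2).restrict hB.compl).addMultiset (points p.1.2) with hκdef
  have hκ : Measurable κ := by
    have h0 : Measurable fun ω => (η ω).restrict hB.compl :=
      (Configuration.measurable_restrict hB.compl).comp hη.measurable
    exact (Configuration.measurable_addMultiset_sample h0).comp measurable_swap
  have := Measure.isProbabilityMeasure_map (μ := P) hη.measurable.aemeasurable
  have := Measure.isProbabilityMeasure_map (μ := ρ.prod P) hκ.aemeasurable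
  have hfin (A : Set X) (hA : MeasurableSet A) (hνA : ν A < ∞) :
      ∀ᵐ p ∂ρ.prod P, (κ p).1 A < ∞ := by
    have h1 : ∀ᵐ p ∂ρ.prod P, (η p.2).1 A < ∞ :=
      Measure.quasiMeasurePreserving_snd.ae (hη.ae_lt_top hA hνA)
    filter_upwards [h1] with p hp
    simp only [hκdef, Configuration.addMultiset_points_val, Measure.add_apply,
      Measure.finsetSum_apply]
    refine ENNReal.add_lt_top.2 ⟨(Measure.restrict_apply_le _ _).trans_lt hp, ?_⟩
    exact ENNReal.sum_lt_top.2 fun i _ => measure_lt_top _ _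
  have hfin1 (A : Set X) (hA : MeasurableSet A) (hνA : ν A < ∞) :
      ∀ᵐ μ ∂P.map η, μ.1 A < ∞ :=
    (ae_map_iff hη.measurable.aemeasurable
      (measurableSet_lt (Configuration.measurable_apply hA) measurable_const)).2
      (hη.ae_lt_top hA hνA)
  have hfin2 (A : Set X) (hA : MeasurableSet A) (hνA : ν A < ∞) :
      ∀ᵐ μ ∂(ρ.prod P).map κ, μ.1 A < ∞ :=
    (ae_map_iff hκ.aemeasurable
      (measurableSet_lt (Configuration.measurable_apply hA) measurable_const)).2 (hfin A hA hνA)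
  refine ext_of_integral_exp (ν := ν) hfin1 hfin2 fun g hg => ?_
  have hsupp := SimpleFunc.finMeasSupp_iff_support.1 hg
  rw [integral_map hη.measurable.aemeasurable (aestronglyMeasurable_exp_integral
      (hfin1 _ g.measurableSet_support hsupp)),
    integral_map hκ.aemeasurable (aestronglyMeasurable_exp_integral
      (hfin2 _ g.measurableSet_support hsupp)),
    hη.integral_exp_integral hg]
  have hgc : (g.restrict Bᶜ).FinMeasSupp ν := by
    rw [SimpleFunc.finMeasSupp_iff_support, SimpleFunc.coe_restrict _ hB.compl,
      Set.support_indicator]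
    exact (measure_mono Set.inter_subset_right).trans_lt
      (SimpleFunc.finMeasSupp_iff_support.1 hg)
  have hae : ∀ᵐ p ∂ρ.prod P, Complex.exp ((∫ x, g x ∂(κ p).1 : ℝ) * Complex.I)
      = Complex.exp ((∑ i, g (p.1.2 i) : ℝ) * Complex.I)
        * Complex.exp ((∫ x, g.restrict Bᶜ x ∂(η p.2).1 : ℝ) * Complex.I) := by
    have h1 : ∀ᵐ p ∂ρ.prod P, (η p.2).1 (Function.support g) < ∞ :=
      Measure.quasiMeasurePreserving_snd.ae (hη.ae_lt_top g.measurableSet_support hsupp)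
    filter_upwards [h1] with p hp
    have i1 : Integrable g ((η p.2).1.restrict Bᶜ) :=
      ((SimpleFunc.finMeasSupp_iff_support.2 hp).integrable).integrableOn
    have i2 (i : Fin p.1.1) : Integrable g (Measure.dirac (p.1.2 i)) :=
      g.integrable_of_isFiniteMeasure
    have e : ∫ x, g x ∂(κ p).1
        = ∑ i, g (p.1.2 i) + ∫ x, g.restrict Bᶜ x ∂(η p.2).1 := by
      simp only [hκdef, Configuration.addMultiset_points_val, Configuration.restrict_val]
      rw [integral_add_measure i1 ((integrable_finsetSum_measure).2 fun i _ => i2 i),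
        integral_finsetSum_measure fun i _ => i2 i, add_comm,
        SimpleFunc.coe_restrict _ hB.compl, integral_indicator hB.compl]
      congr 1
      exact Finset.sum_congr rfl fun i _ =>
        integral_dirac' _ _ g.stronglyMeasurable
    rw [e, ← Complex.exp_add]
    push_cast
    ring_nf
  rw [integral_congr_ae hae,
    integral_prod_mul (fun s : Σ n, Fin n → X =>
      Complex.exp ((∑ i, g (s.2 i) : ℝ) * Complex.I))
      (fun ω => Complex.exp ((∫ x, g.restrict Bᶜ x ∂(η ω).1 : ℝ) * Complex.I)),
    integral_exp_poissonSample _ g.measurable, hη.integral_exp_integral hgc, ← Complex.exp_add]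
  congr 1
  have e (x : X) : Complex.exp (g.restrict Bᶜ x * Complex.I) - 1
      = Bᶜ.indicator (fun x => Complex.exp (g x * Complex.I) - 1) x := by
    rw [SimpleFunc.coe_restrict _ hB.compl]
    by_cases hx : x ∈ B <;> simp [hx]
  simp only [e]
  rw [integral_indicator hB.compl, integral_add_compl hB (integrable_exp_sub_one hg)]

end CharacteristicFunctional

/-! ### The variance bound on sets of finite intensity -/

section VarianceBound

universe u

variable {X : Type u} {Ω : Type*} [MeasurableSpace X] [MeasurableSpace Ω] {ν : Measure X}
  {P : Measure Ω} {η : Ω → Configuration X} {f : Configuration X → ℝ}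

/-- The functional `M ↦ E f(η + ∑_{z ∈ M} δ_z)`; it takes the junk value `0` where the
expectation does not exist. -/
noncomputable def meanAdd (P : Measure Ω) (η : Ω → Configuration X) (f : Configuration X → ℝ)
    (M : Multiset X) : ℝ :=
  ∫ ω, f ((η ω).addMultiset M) ∂P

/-- The functional `M ↦ E |f(η + ∑_{z ∈ M} δ_z)|`, with values in `[0, ∞]`. -/
noncomputable def absMeanAdd (P : Measure Ω) (η : Ω → Configuration X) (f : Configuration X → ℝ)
    (M : Multiset X) : ℝ≥0∞ :=
  ∫⁻ ω, ‖f ((η ω).addMultiset M)‖ₑ ∂P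

lemma measurable_comp_addMultiset_points (hη : Measurable η) (hf : Measurable f) {ι : Type*}
    [Fintype ι] : Measurable fun p : (ι → X) × Ω => f ((η p.2).addMultiset (points p.1)) :=
  hf.comp (Configuration.measurable_addMultiset_points (hη.comp measurable_snd) measurable_fst)

lemma measurable_meanAdd_points [SFinite P] (hη : Measurable η) (hf : Measurable f) {ι : Type*}
    [Fintype ι] : Measurable fun x : ι → X => meanAdd P η f (points x) :=
  (measurable_comp_addMultiset_points hη hf).stronglyMeasurable.integral_prod_right.measurable

lemma jointlyMeasurable_meanAdd [SFinite P] (hη : Measurable η) (hf : Measurable f) :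
    JointlyMeasurable fun _ : PUnit.{u + 1} => meanAdd P η f := fun _ =>
  (measurable_meanAdd_points hη hf).comp measurable_snd

lemma jointlyMeasurable_absMeanAdd [SFinite P] (hη : Measurable η) (hf : Measurable f) :
    JointlyMeasurable fun _ : PUnit.{u + 1} => absMeanAdd P η f := fun _ =>
  (measurable_comp_addMultiset_points hη hf).enorm.lintegral_prod_right'.comp measurable_snd

lemma measurable_comp_addMultiset (hη : Measurable η) (hf : Measurable f) (M : Multiset X) :
    Measurable fun ω => f ((η ω).addMultiset M) := by
  obtain ⟨x, hx⟩ := exists_points_eq M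
  rw [← hx]
  exact (measurable_comp_addMultiset_points hη hf).comp measurable_prodMk_left

lemma measurable_iterCost_meanAdd [SFinite P] (hη : Measurable η) (hf : Measurable f) (n : ℕ) :
    Measurable fun y : Fin n → X => iterCost (points y) (meanAdd P η f) 0 := by
  have h1 := ((jointlyMeasurable_meanAdd (P := P) hη hf).iterCost n).comp
    (κ := fun y : Fin n → X => (PUnit.unit.{u + 1}, y)) (by fun_prop)
  exact h1.measurable_left 0

lemma enorm_meanAdd_le (M : Multiset X) : ‖meanAdd P η f M‖ₑ ≤ absMeanAdd P η f M :=
  enorm_integral_le_lintegral_enorm _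

lemma Configuration.measurable_addMultiset (M : Multiset X) :
    Measurable fun μ : Configuration X => μ.addMultiset M := by
  obtain ⟨x, hx⟩ := exists_points_eq M
  rw [← hx]
  exact measurable_addMultiset_points measurable_id measurable_const

lemma mul_le_sq_add_sq (a b : ℝ≥0∞) : a * b ≤ a ^ 2 + b ^ 2 := by
  rcases le_total a b with h | h
  · calc a * b ≤ b * b := by gcongr
      _ ≤ _ := by rw [← sq]; exact le_add_self
  · calc a * b ≤ a * a := by gcongr
      _ ≤ _ := by rw [← sq]; exact le_self_add

variable [IsProbabilityMeasure P] [SigmaFinite ν] (hη : IsPoissonProcess η ν P) {B : Set X}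
  (hB : MeasurableSet B) [IsFiniteMeasure (ν.restrict B)]

/-- The process outside of `B`, with an independent Poisson sample in `B` added, as a function on
the product space. -/
noncomputable def resample (η : Ω → Configuration X) (hB : MeasurableSet B)
    (p : (Σ n, Fin n → X) × Ω) : Configuration X :=
  ((η p.2).restrict hB.compl).addMultiset (points p.1.2)

omit [IsProbabilityMeasure P] [SigmaFinite ν] [IsFiniteMeasure (ν.restrict B)] in
include hη in
lemma IsPoissonProcess.measurable_restrict : Measurable fun ω => (η ω).restrict hB.compl :=
  (Configuration.measurable_restrict hB.compl).comp hη.measurable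

omit [IsProbabilityMeasure P] [SigmaFinite ν] [IsFiniteMeasure (ν.restrict B)] in
include hη in
lemma IsPoissonProcess.measurable_resample : Measurable (resample η hB) :=
  (Configuration.measurable_addMultiset_sample (hη.measurable_restrict hB)).comp measurable_swap

include hη in
lemma IsPoissonProcess.map_eq_map_resample :
    P.map η = ((poissonSample (ν.restrict B)).prod P).map (resample η hB) :=
  hη.map_eq_map_addMultiset hB

include hη in
lemma IsPoissonProcess.lintegral_resample {κ : Configuration X → ℝ≥0∞} (hκ : Measurable κ) :
    ∫⁻ p, κ (resample η hB p) ∂(poissonSample (ν.restrict B)).prod P = ∫⁻ ω, κ (η ω) ∂P := by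
  rw [← lintegral_map hκ (hη.measurable_resample hB), ← hη.map_eq_map_resample hB,
    lintegral_map hκ hη.measurable]

include hη in
lemma IsPoissonProcess.integral_resample {κ : Configuration X → ℝ} (hκ : Measurable κ) :
    ∫ p, κ (resample η hB p) ∂(poissonSample (ν.restrict B)).prod P = ∫ ω, κ (η ω) ∂P := by
  rw [← integral_map (hη.measurable_resample hB).aemeasurable hκ.aestronglyMeasurable,
    ← hη.map_eq_map_resample hB, integral_map hη.measurable.aemeasurable hκ.aestronglyMeasurable]

include hη in
lemma IsPoissonProcess.memLp_resample (hf : Measurable f) (hL : MemLp (fun ω => f (η ω)) 2 P) :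
    MemLp (fun p => f (resample η hB p)) 2 ((poissonSample (ν.restrict B)).prod P) := by
  have h1 : MemLp f 2 (P.map η) :=
    (memLp_map_measure_iff hf.aestronglyMeasurable hη.measurable.aemeasurable).2 hL
  rw [hη.map_eq_map_resample hB] at h1
  exact (memLp_map_measure_iff hf.aestronglyMeasurable
    (hη.measurable_resample hB).aemeasurable).1 h1

omit [MeasurableSpace Ω] in
lemma addMultiset_resample (A : Multiset X) (p : (Σ n, Fin n → X) × Ω) :
    (resample η hB p).addMultiset A
      = ((η p.2).restrict hB.compl).addMultiset (A + points p.1.2) := by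
  rw [resample, ← Configuration.addMultiset_add]

include hη in
lemma IsPoissonProcess.lintegral_absMeanAdd (hf : Measurable f) (A : Multiset X) :
    ∫⁻ s, absMeanAdd P (fun ω => (η ω).restrict hB.compl) f (A + points s.2)
        ∂poissonSample (ν.restrict B)
      = absMeanAdd P η f A := by
  have hm : Measurable fun μ : Configuration X => f (μ.addMultiset A) :=
    hf.comp (Configuration.measurable_addMultiset A)
  have h := hη.lintegral_resample hB hm.enorm
  have hm' : Measurable fun p => ‖f ((resample η hB p).addMultiset A)‖ₑ :=
    hm.enorm.comp (hη.measurable_resample hB)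
  rw [lintegral_prod _ hm'.aemeasurable] at h
  simp only [addMultiset_resample] at h
  exact h

include hη in
lemma IsPoissonProcess.integral_meanAdd (hf : Measurable f) (A : Multiset X)
    (hA : absMeanAdd P η f A ≠ ∞) :
    Integrable (fun s => meanAdd P (fun ω => (η ω).restrict hB.compl) f (A + points s.2))
      (poissonSample (ν.restrict B)) ∧
    ∫ s, meanAdd P (fun ω => (η ω).restrict hB.compl) f (A + points s.2)
        ∂poissonSample (ν.restrict B)
      = meanAdd P η f A := by
  have hm : Measurable fun μ : Configuration X => f (μ.addMultiset A) :=
    hf.comp (Configuration.measurable_addMultiset A)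
  have hint : Integrable (fun p => f ((resample η hB p).addMultiset A))
      ((poissonSample (ν.restrict B)).prod P) := by
    refine ⟨(hm.comp (hη.measurable_resample hB)).aestronglyMeasurable, ?_⟩
    rw [hasFiniteIntegral_iff_enorm, hη.lintegral_resample hB hm.enorm]
    exact hA.lt_top
  have h := hη.integral_resample hB hm
  rw [integral_prod _ hint] at h
  have h2 := hint.integral_prod_left
  simp only [addMultiset_resample] at h h2
  exact ⟨h2, h⟩

include hη in
/-- A square-integrable functional has exponential moments, since the number of points does. -/
lemma IsPoissonProcess.hasExpMoments_absMeanAdd (hf : Measurable f)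
    (hL : MemLp (fun ω => f (η ω)) 2 P) :
    HasExpMoments (ν.restrict B) (absMeanAdd P (fun ω => (η ω).restrict hB.compl) f) := by
  intro p
  have hm : Measurable fun q : (Σ n, Fin n → X) × Ω => f (resample η hB q) :=
    hf.comp (hη.measurable_resample hB)
  have hp : Measurable fun q : (Σ n, Fin n → X) × Ω => (2 : ℝ≥0∞) ^ (p * q.1.1) := by
    have h1 : JointlyMeasurable fun (_ : PUnit.{u + 1}) (M : Multiset X) =>
        (1 : ℝ≥0∞) := fun k => measurable_const
    have h2 := (h1.mul_pow p).measurable_right PUnit.unit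
    simp only [one_mul, card_points, Fintype.card_fin] at h2
    exact h2.comp measurable_fst
  have e : ∫⁻ s, absMeanAdd P (fun ω => (η ω).restrict hB.compl) f (points s.2) * 2 ^ (p * s.1)
        ∂poissonSample (ν.restrict B)
      = ∫⁻ q, ‖f (resample η hB q)‖ₑ * 2 ^ (p * q.1.1)
        ∂(poissonSample (ν.restrict B)).prod P := by
    have hmp : Measurable fun q : (Σ n, Fin n → X) × Ω =>
        ‖f (resample η hB q)‖ₑ * 2 ^ (p * q.1.1) := hm.enorm.mul hp
    rw [lintegral_prod _ hmp.aemeasurable]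
    refine lintegral_congr fun s => ?_
    exact (lintegral_mul_const' _ _ (by finiteness)).symm
  rw [e]
  refine ne_top_of_le_ne_top ?_ (lintegral_mono fun q => mul_le_sq_add_sq _ _)
  rw [lintegral_add_left (hm.enorm.pow_const 2)]
  refine ENNReal.add_ne_top.2 ⟨?_, ?_⟩
  · have h := (hη.memLp_resample hB hf hL).integrable_sq.2
    rw [hasFiniteIntegral_iff_enorm] at h
    simpa only [enorm_pow] using h.ne
  · have h := lintegral_pow_poissonSample (ν.restrict B) (t := 2 ^ (2 * p)) (by positivity)
    have e2 : ENNReal.ofReal (2 ^ (2 * p)) = 2 ^ (2 * p) := by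
      rw [ENNReal.ofReal_pow (by norm_num)]
      norm_num
    rw [e2] at h
    rw [lintegral_prod _ (hp.pow_const 2).aemeasurable]
    simp only [lintegral_const, measure_univ, mul_one]
    have e3 (s : Σ n, Fin n → X) : ((2 : ℝ≥0∞) ^ (p * s.1)) ^ 2 = (2 ^ (2 * p)) ^ s.1 := by
      rw [← pow_mul, ← pow_mul]
      congr 1
      ring
    simp only [e3, h]
    finiteness

include hη hB in
/-- For almost every choice of points in `B`, the expectation of `f` at `η` with any of these
points added exists. -/
lemma IsPoissonProcess.ae_absMeanAdd_ne_top (hf : Measurable f)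
    (hL : MemLp (fun ω => f (η ω)) 2 P) (n : ℕ) :
    ∀ᵐ y ∂Measure.pi (fun _ : Fin n => ν.restrict B), ∀ A ≤ points y,
      absMeanAdd P η f A ≠ ∞ := by
  set a := absMeanAdd P (fun ω => (η ω).restrict hB.compl) f with ha_def
  have ha : JointlyMeasurable fun _ : PUnit.{u + 1} => a :=
    jointlyMeasurable_absMeanAdd (hη.measurable_restrict hB) hf
  have hmeas : Measurable fun y : Fin n → X =>
      ∫⁻ s, subsetSum (points y) a (points s.2) * 2 ^ (0 * s.1)
        ∂poissonSample (ν.restrict B) := by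
    have h1 := ((ha.subsetSum n).mul_pow 0).comp
      (κ := fun y : Fin n → X => (PUnit.unit.{u + 1}, y)) (by fun_prop)
    have h2 := h1.measurable_prod.lintegral_prod_right' (ν := poissonSample (ν.restrict B))
    simpa only [card_points, Fintype.card_fin] using h2
  have h := MeasureTheory.ae_lt_top (μ := Measure.pi (fun _ : Fin n => ν.restrict B)) hmeas
    (ne_top_of_le_ne_top (ENNReal.mul_ne_top (by finiteness)
      (hη.hasExpMoments_absMeanAdd hB hf hL _)) (lintegral_subsetSum_le (ν.restrict B) n ha 0))
  filter_upwards [h] with y hy A hA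
  rw [← hη.lintegral_absMeanAdd hB hf A]
  refine ne_top_of_le_ne_top hy.ne (lintegral_mono fun s => ?_)
  simpa using le_subsetSum hA a (points s.2)

include hη in
/-- The expectation of the iterated add-one cost, computed from the Poisson sample in `B`. -/
lemma IsPoissonProcess.integral_iterCost_meanAdd (hf : Measurable f) {Y : Multiset X}
    (hY : ∀ A ≤ Y, absMeanAdd P η f A ≠ ∞) :
    ∫ s, iterCost Y (meanAdd P (fun ω => (η ω).restrict hB.compl) f) (points s.2)
        ∂poissonSample (ν.restrict B)
      = iterCost Y (meanAdd P η f) 0 := by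
  simp only [iterCost, add_zero]
  have key (T : Multiset (Multiset X)) (hT : ∀ A ∈ T, A ≤ Y) :
      Integrable (fun s : Σ n, Fin n → X => (T.map fun A => (-1) ^ (Y.card + A.card) *
          meanAdd P (fun ω => (η ω).restrict hB.compl) f (A + points s.2)).sum)
        (poissonSample (ν.restrict B)) ∧
      ∫ s, (T.map fun A => (-1) ^ (Y.card + A.card) *
          meanAdd P (fun ω => (η ω).restrict hB.compl) f (A + points s.2)).sum
          ∂poissonSample (ν.restrict B)
        = (T.map fun A => (-1) ^ (Y.card + A.card) * meanAdd P η f A).sum := by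
    induction T using Multiset.induction_on with
    | empty => simp
    | cons A T ih =>
      obtain ⟨i1, e1⟩ := ih fun A' hA' => hT A' (Multiset.mem_cons_of_mem hA')
      obtain ⟨i2, e2⟩ := hη.integral_meanAdd hB hf A (hY A (hT A (Multiset.mem_cons_self A T)))
      simp only [Multiset.map_cons, Multiset.sum_cons]
      refine ⟨(i2.const_mul _).add i1, ?_⟩
      rw [integral_add (i2.const_mul _) i1, e1, integral_const_mul, e2]
  exact (key _ fun A hA => Multiset.mem_powerset.1 hA).2

include hη hB in
/-- The square of the distance of `f(η)` to its mean plus the multiple integral of `g` is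
nonnegative; together with the duality and the isometry this bounds the variance from below. -/
lemma IsPoissonProcess.two_mul_integral_sub_le_variance (hf : Measurable f)
    (hL : MemLp (fun ω => f (η ω)) 2 P) {n : ℕ} (hn : n ≠ 0) {g : Multiset X → ℝ}
    (hg : JointlyMeasurable fun _ : PUnit.{u + 1} => g) {C : ℝ} (hC : ∀ M, |g M| ≤ C) :
    2 * ∫ y : Fin n → X, g (points y) * iterCost (points y) (meanAdd P η f) 0
          ∂Measure.pi (fun _ => ν.restrict B)
        - n ! * ∫ y : Fin n → X, g (points y) ^ 2 ∂Measure.pi (fun _ => ν.restrict B)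
      ≤ variance (fun ω => f (η ω)) P := by
  set m := ν.restrict B with hm_def
  set ρ := poissonSample m with hρ
  set G := meanAdd P (fun ω => (η ω).restrict hB.compl) f with hG_def
  set W := wienerIto m n g with hW_def
  have hG : JointlyMeasurable fun _ : PUnit.{u + 1} => G :=
    jointlyMeasurable_meanAdd (hη.measurable_restrict hB) hf
  have hGexp : HasExpMoments m fun M => ‖G M‖ₑ :=
    (hη.hasExpMoments_absMeanAdd hB hf hL).mono fun M => enorm_meanAdd_le M
  have hW : JointlyMeasurable fun _ : PUnit.{u + 1} => W := hg.wienerIto_unit m n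
  have hWb := abs_wienerIto_le m n hC
  -- The multiple integral and the centred functional are square integrable.
  have hWsq : Integrable (fun s : Σ n, Fin n → X => W (points s.2) ^ 2) ρ := by
    simp only [sq]
    exact HasExpMoments.integrable_mul hW hW (hasExpMoments_of_bound m hWb) hWb
  have hW2 : MemLp (fun p : (Σ n, Fin n → X) × Ω => W (points p.1.2)) 2 (ρ.prod P) := by
    have hWm : Measurable fun p : (Σ n, Fin n → X) × Ω => W (points p.1.2) :=
      (hW.measurable_right PUnit.unit).comp measurable_fst
    rw [memLp_two_iff_integrable_sq hWm.aestronglyMeasurable]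
    exact hWsq.comp_fst P
  have hh := hη.memLp_resample hB hf hL
  set e := ∫ ω, f (η ω) ∂P with he
  have ha : MemLp (fun p => f (resample η hB p) - e) 2 (ρ.prod P) := hh.sub (memLp_const e)
  have hvar : variance (fun ω => f (η ω)) P
      = ∫ p, (f (resample η hB p) - e) ^ 2 ∂ρ.prod P := by
    have hfη : Measurable fun ω => f (η ω) := hf.comp hη.measurable
    rw [variance_eq_integral hfη.aemeasurable,
      hη.integral_resample hB (κ := fun μ => (f μ - e) ^ 2) (by fun_prop)]
  have hcross : ∫ p, (f (resample η hB p) - e) * W (points p.1.2) ∂ρ.prod P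
      = ∫ y : Fin n → X, g (points y) * iterCost (points y) (meanAdd P η f) 0
          ∂Measure.pi (fun _ => m) := by
    have i1 : Integrable (fun p => f (resample η hB p) * W (points p.1.2)) (ρ.prod P) :=
      hh.integrable_mul hW2
    have i2 : Integrable (fun p : (Σ n, Fin n → X) × Ω => e * W (points p.1.2)) (ρ.prod P) :=
      (hW2.integrable one_le_two).const_mul e
    have e2 : ∫ p : (Σ n, Fin n → X) × Ω, W (points p.1.2) ∂ρ.prod P = 0 := by
      rw [integral_prod _ (hW2.integrable one_le_two)]
      have hc (s : Σ n, Fin n → X) : ∫ _, W (points s.2) ∂P = W (points s.2) := by simp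
      simp only [hc]
      exact integral_wienerIto m hn hg hC
    simp only [sub_mul]
    rw [integral_sub i1 i2, integral_const_mul, e2, mul_zero, sub_zero, integral_prod _ i1]
    have hc (s : Σ n, Fin n → X) : ∫ ω, f (resample η hB (s, ω)) * W (points s.2) ∂P
        = G (points s.2) * W (points s.2) := integral_mul_const _ _
    simp only [hc]
    refine (integral_mul_wienerIto m n hG hGexp hg hC).trans (integral_congr_ae ?_)
    filter_upwards [hη.ae_absMeanAdd_ne_top hB hf hL n] with y hy
    rw [hη.integral_iterCost_meanAdd hB hf hy]
  have hsq : ∫ p : (Σ n, Fin n → X) × Ω, W (points p.1.2) ^ 2 ∂ρ.prod P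
      = n ! * ∫ y : Fin n → X, g (points y) ^ 2 ∂Measure.pi (fun _ => m) := by
    rw [integral_prod _ (hWsq.comp_fst P)]
    have hc (s : Σ n, Fin n → X) : ∫ _, W (points s.2) ^ 2 ∂P = W (points s.2) ^ 2 := by simp
    simp only [hc]
    exact integral_wienerIto_sq m n hg hC
  have hpos : 0 ≤ ∫ p, (f (resample η hB p) - e - W (points p.1.2)) ^ 2 ∂ρ.prod P :=
    integral_nonneg fun p => sq_nonneg _
  have hexp (p : (Σ n, Fin n → X) × Ω) : (f (resample η hB p) - e - W (points p.1.2)) ^ 2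
      = (f (resample η hB p) - e) ^ 2 - 2 * ((f (resample η hB p) - e) * W (points p.1.2))
        + W (points p.1.2) ^ 2 := by ring
  have i3 : Integrable (fun p => 2 * ((f (resample η hB p) - e) * W (points p.1.2)))
      (ρ.prod P) := (ha.integrable_mul hW2).const_mul 2
  have i4 : Integrable (fun p => (f (resample η hB p) - e) ^ 2
      - 2 * ((f (resample η hB p) - e) * W (points p.1.2))) (ρ.prod P) := ha.integrable_sq.sub i3
  simp only [hexp] at hpos
  rw [integral_add i4 hW2.integrable_sq, integral_sub ha.integrable_sq i3, integral_const_mul, hcross, hsq, ← hvar] at hpos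
  linarith

include hη hB in
/-- The test kernel `g = (t² / n!) w⁻¹ 1{|w| ≥ t}`, where `w(y) = E D_y f(η)`, gives the variance
bound in terms of the measure of the superlevel set of `|w|`. -/
lemma IsPoissonProcess.mul_measureReal_le_variance (hf : Measurable f)
    (hL : MemLp (fun ω => f (η ω)) 2 P) {n : ℕ} (hn : n ≠ 0) {t : ℝ} (ht : 0 < t) :
    t ^ 2 / n ! * (Measure.pi fun _ : Fin n => ν.restrict B).real
        {y | t ≤ |iterCost (points y) (meanAdd P η f) 0|}
      ≤ variance (fun ω => f (η ω)) P := by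
  set w : Multiset X → ℝ := fun Y => iterCost Y (meanAdd P η f) 0 with hw
  have hwm (k : ℕ) : Measurable fun y : Fin k → X => w (points y) :=
    measurable_iterCost_meanAdd hη.measurable hf k
  set S : Set ℝ := {r | t ≤ |r|} with hS
  have hSm : MeasurableSet S := measurableSet_le measurable_const measurable_id.abs
  set κ : ℝ → ℝ := S.indicator fun r => t ^ 2 / n ! * r⁻¹ with hκ
  have hκm : Measurable κ := (measurable_inv.const_mul _).indicator hSm
  have hg : JointlyMeasurable fun (_ : PUnit.{u + 1}) Y => κ (w Y) := fun k =>
    hκm.comp ((hwm k).comp measurable_snd)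
  have hf0 : (0 : ℝ) < n ! := by exact_mod_cast Nat.factorial_pos n
  have hb (r : ℝ) : |κ r| ≤ t / n ! := by
    by_cases hr : r ∈ S
    · have hr' : t ≤ |r| := hr
      rw [hκ, Set.indicator_of_mem hr, abs_mul, abs_inv, abs_of_pos (by positivity),
        ← div_eq_mul_inv, div_le_iff₀ (ht.trans_le hr')]
      calc t ^ 2 / n ! = t / n ! * t := by ring
        _ ≤ _ := by gcongr
    · rw [hκ, Set.indicator_of_notMem hr, abs_zero]
      positivity
  have h := hη.two_mul_integral_sub_le_variance hB hf hL hn hg (fun M => hb (w M))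
  set A : Set (Fin n → X) := {y | t ≤ |w (points y)|} with hA
  have hAm : MeasurableSet A := measurableSet_le measurable_const (hwm n).abs
  set μ := Measure.pi fun _ : Fin n => ν.restrict B with hμ
  have e1 : ∫ y : Fin n → X, κ (w (points y)) * w (points y) ∂μ = t ^ 2 / n ! * μ.real A := by
    have : (fun y : Fin n → X => κ (w (points y)) * w (points y))
        = A.indicator fun _ => t ^ 2 / n ! := by
      funext y
      by_cases hy : y ∈ A
      · have hy' : w (points y) ∈ S := hy
        have hy0 : w (points y) ≠ 0 := abs_pos.1 (ht.trans_le hy)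
        rw [Set.indicator_of_mem hy, hκ, Set.indicator_of_mem hy']
        field_simp
      · have hy' : w (points y) ∉ S := hy
        rw [Set.indicator_of_notMem hy, hκ, Set.indicator_of_notMem hy', zero_mul]
    rw [this, integral_indicator_const _ hAm, smul_eq_mul, mul_comm]
  have e2 : ∫ y : Fin n → X, κ (w (points y)) ^ 2 ∂μ ≤ (t / n !) ^ 2 * μ.real A := by
    have : ∫ y, A.indicator (fun _ => (t / n !) ^ 2) y ∂μ = (t / n !) ^ 2 * μ.real A := by
      rw [integral_indicator_const _ hAm, smul_eq_mul, mul_comm]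
    rw [← this]
    refine integral_mono_of_nonneg (Filter.Eventually.of_forall fun y => sq_nonneg _)
      ((integrable_const _).indicator hAm) (Filter.Eventually.of_forall fun y => ?_)
    by_cases hy : y ∈ A
    · simp only [Set.indicator_of_mem hy]
      exact sq_le_sq' (abs_le.1 (hb _)).1 (abs_le.1 (hb _)).2
    · have hy' : w (points y) ∉ S := hy
      simp only [Set.indicator_of_notMem hy, hκ, Set.indicator_of_notMem hy']
      norm_num
  rw [e1] at h
  have e3 : n ! * ((t / n !) ^ 2 * μ.real A) = t ^ 2 / n ! * μ.real A := by
    field_simp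
  have e4 := mul_le_mul_of_nonneg_left e2 hf0.le
  rw [e3] at e4
  linarith

end VarianceBound

/-! ### Exhaustion, and the covering of `U` by superlevel sets -/

section Exhaustion

universe u

variable {X : Type u} {Ω : Type*} [MeasurableSpace X] [MeasurableSpace Ω] {ν : Measure X}
  {P : Measure Ω} {η : Ω → Configuration X} {f : Configuration X → ℝ}

lemma isFiniteMeasure_restrict_spanning (ν : Measure X) [SigmaFinite ν] (j : ℕ) :
    IsFiniteMeasure (ν.restrict (spanningSets ν j)) :=
  ⟨by simpa using measure_spanningSets_lt_top ν j⟩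

lemma monotone_pi_spanningSets (ν : Measure X) [SigmaFinite ν] (ι : Type*) :
    Monotone fun j => Set.univ.pi fun _ : ι => spanningSets ν j := fun _ _ hij =>
  Set.pi_mono fun _ _ => spanningSets_mono hij

lemma iUnion_pi_spanningSets (ν : Measure X) [SigmaFinite ν] (ι : Type*) [Finite ι] :
    ⋃ j, (Set.univ.pi fun _ : ι => spanningSets ν j) = Set.univ := by
  rw [Set.iUnion_univ_pi_of_monotone fun _ => monotone_spanningSets ν]
  simp [iUnion_spanningSets]

variable [IsProbabilityMeasure P] [SigmaFinite ν]

/-- The variance bound on all of `Xⁿ`, by monotone exhaustion with sets of finite intensity. -/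
lemma IsPoissonProcess.mul_pi_le_variance (hη : IsPoissonProcess η ν P) (hf : Measurable f)
    (hL : MemLp (fun ω => f (η ω)) 2 P) {n : ℕ} (hn : n ≠ 0) {t : ℝ} (ht : 0 < t) :
    ENNReal.ofReal (t ^ 2 / n !) * (Measure.pi fun _ : Fin n => ν)
        {y | t ≤ |iterCost (points y) (meanAdd P η f) 0|}
      ≤ ENNReal.ofReal (variance (fun ω => f (η ω)) P) := by
  set A : Set (Fin n → X) := {y | t ≤ |iterCost (points y) (meanAdd P η f) 0|} with hA
  have e : (Measure.pi fun _ : Fin n => ν) A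
      = ⨆ j, (Measure.pi fun _ : Fin n => ν) (A ∩ Set.univ.pi fun _ => spanningSets ν j) := by
    rw [← Monotone.measure_iUnion, ← Set.inter_iUnion, iUnion_pi_spanningSets, Set.inter_univ]
    exact fun i j hij => Set.inter_subset_inter_right _ (monotone_pi_spanningSets ν _ hij)
  rw [e, ENNReal.mul_iSup]
  refine iSup_le fun j => ?_
  have := isFiniteMeasure_restrict_spanning ν j
  have hAm : MeasurableSet A :=
    measurableSet_le measurable_const (measurable_iterCost_meanAdd hη.measurable hf n).abs
  rw [← Measure.restrict_apply hAm, Measure.restrict_pi_pi, ← ofReal_measureReal,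
    ← ENNReal.ofReal_mul (by positivity)]
  exact ENNReal.ofReal_le_ofReal
    (hη.mul_measureReal_le_variance (measurableSet_spanningSets ν j) hf hL hn ht)

omit [SigmaFinite ν] in
lemma measurable_iterCost_meanAdd_fintype (hη : Measurable η) (hf : Measurable f) {ι : Type*}
    [Fintype ι] : Measurable fun y : ι → X => iterCost (points y) (meanAdd P η f) 0 := by
  have e := (Fintype.equivFin ι).symm
  have h : Measurable fun y : ι → X => y ∘ e := measurable_pi_iff.2 fun i => measurable_pi_apply _
  simpa only [Function.comp_def, ← points_comp_equiv e] using
    (measurable_iterCost_meanAdd (P := P) hη hf _).comp h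

lemma IsPoissonProcess.mul_powMeasure_le_variance (hη : IsPoissonProcess η ν P)
    (hf : Measurable f) (hL : MemLp (fun ω => f (η ω)) 2 P) {ι : Type*} [Fintype ι] [Nonempty ι]
    {t : ℝ} (ht : 0 < t) :
    ENNReal.ofReal (t ^ 2 / (Fintype.card ι)!) * powMeasure ι ν
        {y | t ≤ |iterCost (points y) (meanAdd P η f) 0|}
      ≤ ENNReal.ofReal (variance (fun ω => f (η ω)) P) := by
  refine le_trans (le_of_eq ?_)
    (hη.mul_pi_le_variance hf hL (n := Fintype.card ι) Fintype.card_ne_zero ht)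
  congr 1
  set e := (Fintype.equivFin ι).symm
  have hmp := measurePreserving_piCongrLeft (fun _ : ι => ν) e
  rw [powMeasure, ← hmp.measure_preimage_equiv]
  congr 1
  ext y
  have hy : MeasurableEquiv.piCongrLeft (fun _ : ι => X) e y = y ∘ e.symm := by
    funext i
    obtain ⟨j, rfl⟩ := e.surjective i
    rw [MeasurableEquiv.piCongrLeft_apply_apply]
    simp
  simp only [Set.mem_preimage, Set.mem_ofPred_eq, hy, points_comp_equiv]

lemma IsPoissonProcess.ae_integrable_addPoints (hη : IsPoissonProcess η ν P) (hf : Measurable f)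
    (hL : MemLp (fun ω => f (η ω)) 2 P) (k : ℕ) :
    ∀ᵐ x ∂powMeasure (Fin k) ν, ∀ I : Finset (Fin k),
      Integrable (fun ω => f ((η ω).addPoints I x)) P := by
  have h : ∀ j, ∀ᵐ x ∂(powMeasure (Fin k) ν).restrict
      (Set.univ.pi fun _ => spanningSets ν j), ∀ I : Finset (Fin k),
      Integrable (fun ω => f ((η ω).addPoints I x)) P := by
    intro j
    have := isFiniteMeasure_restrict_spanning ν j
    rw [powMeasure, Measure.restrict_pi_pi]
    filter_upwards [hη.ae_absMeanAdd_ne_top (measurableSet_spanningSets ν j) hf hL k] with x hx I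
    have hI : I.val.map x ≤ points x := Multiset.map_le_map (Finset.val_le_iff.2 I.subset_univ)
    simp only [Configuration.addPoints_eq]
    refine ⟨(measurable_comp_addMultiset hη.measurable hf _).aestronglyMeasurable, ?_⟩
    rw [hasFiniteIntegral_iff_enorm]
    exact (hx _ hI).lt_top
  have h2 := (ae_restrict_iUnion_iff _ _).2 h
  rwa [iUnion_pi_spanningSets, Measure.restrict_univ] at h2

end Exhaustion

lemma points_restrict {X ι : Type*} (J : Finset ι) (x : ι → X) :
    points (J.restrict x) = J.val.map x := by
  have h : J.val = (Finset.univ : Finset J).val.map Subtype.val := by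
    rw [Finset.univ_eq_attach]
    exact (Multiset.attach_map_val J.val).symm
  rw [points, h, Multiset.map_map]
  rfl

/-- If `H(∑_{i ∈ I₁} δ_{x_i})` and `H(∑_{i ∈ I₂} δ_{x_i})` differ by at least `c`, then one of the
iterated costs `D_{x_J} H(0)`, for nonempty `J`, is at least `c / 2 ^ (k + 1)` in absolute value:
the difference is a sum of at most `2 ^ (k + 1)` of them. -/
lemma exists_le_abs_iterCost {X : Type*} {k : ℕ} (I₁ I₂ : Finset (Fin k)) (x : Fin k → X)
    (H : Multiset X → ℝ) {c : ℝ} (hc : 0 < c)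
    (h : c ≤ |H (I₁.val.map x) - H (I₂.val.map x)|) :
    ∃ J : Finset (Fin k), J.Nonempty ∧ c / 2 ^ (k + 1) ≤ |iterCost (J.val.map x) H 0| := by
  by_contra! hcon
  set t := c / 2 ^ (k + 1) with ht
  have ht0 : 0 < t := by positivity
  have key (I : Finset (Fin k)) : |H (I.val.map x) - H 0| < 2 ^ k * t := by
    have e := eq_sum_iterCost x I H 0
    rw [add_zero, ← Finset.add_sum_erase _ _ (Finset.empty_mem_powerset I)] at e
    simp only [Finset.empty_val, Multiset.map_zero, iterCost_zero] at e
    rw [e, add_sub_cancel_left]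
    have hcard : ((I.powerset.erase ∅).card : ℝ) < 2 ^ k := by
      rw [Finset.card_erase_of_mem (Finset.empty_mem_powerset I), Finset.card_powerset]
      have h1 : 2 ^ I.card ≤ 2 ^ k := Nat.pow_le_pow_right (by norm_num)
        ((Finset.card_le_univ I).trans_eq (Fintype.card_fin k))
      have h2 : 0 < 2 ^ I.card := by positivity
      exact_mod_cast (by omega : 2 ^ I.card - 1 < 2 ^ k)
    calc _ ≤ ∑ J ∈ I.powerset.erase ∅, |iterCost (J.val.map x) H 0| :=
          Finset.abs_sum_le_sum_abs _ _
      _ ≤ ∑ J ∈ I.powerset.erase ∅, t := Finset.sum_le_sum fun J hJ =>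
          (hcon J (Finset.nonempty_iff_ne_empty.2 (Finset.mem_erase.1 hJ).1)).le
      _ = (I.powerset.erase ∅).card * t := by simp
      _ < 2 ^ k * t := by gcongr
  have h1 := abs_sub_lt_iff.1 (key I₁)
  have h2 := abs_sub_lt_iff.1 (key I₂)
  have h3 : c = 2 ^ k * t + 2 ^ k * t := by
    rw [ht]
    field_simp
    ring
  have h4 : |H (I₁.val.map x) - H (I₂.val.map x)| < c := by
    rw [abs_lt]
    constructor <;> linarith [h1.1, h1.2, h2.1, h2.2]
  exact absurd h h4.not_ge

/-- If a set is covered up to a null set by sets indexed by the nonempty subsets of `{1, …, k}`,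
`k ≥ 1`, then one of them has at least the proportion `2 ^ {-(k + 1)}` of its measure. -/
lemma exists_le_measure_of_cover {S : Type*} [MeasurableSpace S] (μ : Measure S) {k : ℕ}
    (hk : 1 ≤ k) {U : Set S} (V : Finset (Fin k) → Set S)
    (hcover : ∀ᵐ x ∂μ, x ∈ U → ∃ J : Finset (Fin k), J.Nonempty ∧ x ∈ V J) :
    ∃ J : Finset (Fin k), J.Nonempty ∧ μ U / 2 ^ (k + 1) ≤ μ (V J) := by
  classical
  by_contra! hcon
  set T : Finset (Finset (Fin k)) := Finset.univ.filter fun J => J.Nonempty with hT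
  have hTne : T.Nonempty := ⟨{⟨0, hk⟩}, by simp [hT]⟩
  have h1 : μ U ≤ μ (⋃ J ∈ T, V J) := by
    refine measure_mono_ae ?_
    filter_upwards [hcover] with x hx hxU
    obtain ⟨J, hJ, hxJ⟩ := hx hxU
    exact Set.mem_biUnion (show J ∈ (T : Set (Finset (Fin k))) by simpa [hT] using hJ) hxJ
  have h2 : μ U < ∑ J ∈ T, μ U / 2 ^ (k + 1) :=
    (h1.trans (measure_biUnion_finset_le T V)).trans_lt
      (ENNReal.sum_lt_sum_of_nonempty hTne fun J hJ => hcon J (Finset.mem_filter.1 hJ).2)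
  have hcard : (T.card : ℝ≥0∞) ≤ 2 ^ (k + 1) := by
    have h3 : T.card ≤ 2 ^ k := by
      simpa using Finset.card_le_univ T
    calc (T.card : ℝ≥0∞) ≤ ((2 ^ k : ℕ) : ℝ≥0∞) := by exact_mod_cast h3
      _ = 2 ^ k := by push_cast; rfl
      _ ≤ 2 ^ (k + 1) := by
          gcongr
          · norm_num
          · omega
  have h4 : ∑ J ∈ T, μ U / 2 ^ (k + 1) ≤ μ U := by
    rw [Finset.sum_const, nsmul_eq_mul]
    calc _ ≤ (2 ^ (k + 1) : ℝ≥0∞) * (μ U / 2 ^ (k + 1)) := by gcongr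
      _ = μ U := ENNReal.mul_div_cancel (by positivity) (by finiteness)
  exact absurd h2 h4.not_gt

theorem theorem5p2 {X Ω : Type*} [MeasurableSpace X] [MeasurableSpace Ω]
    (ν : Measure X) [SigmaFinite ν] (P : Measure Ω) [IsProbabilityMeasure P]
    (η : Ω → Configuration X) (hη : IsPoissonProcess η ν P)
    (F : Ω → ℝ) (hF : MemLp F 2 P)
    (f : Configuration X → ℝ) (hf : Measurable f) (hFf : F =ᵐ[P] fun ω => f (η ω))
    (k : ℕ) (hk : 1 ≤ k) (I₁ I₂ : Finset (Fin k)) (hI : I₁ ∪ I₂ = Finset.univ)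
    (U : Set (Fin k → X)) (hU : MeasurableSet U) (c : ℝ) (hc : 0 < c)
    (hlower : ∀ᵐ x ∂(powMeasure (Fin k) ν), x ∈ U →
      c ≤ |∫ ω, (f ((η ω).addPoints I₁ x) - f ((η ω).addPoints I₂ x)) ∂P|) :
    ENNReal.ofReal (c ^ 2 / (4 ^ (k + 1) * (k ! : ℝ))) * minProjection ν k U
      ≤ ENNReal.ofReal (variance F P) := by
  have hL : MemLp (fun ω => f (η ω)) 2 P := (memLp_congr_ae hFf).1 hF
  rw [variance_congr hFf]
  set w : Multiset X → ℝ := fun Y => iterCost Y (meanAdd P η f) 0 with hw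
  set t := c / 2 ^ (k + 1) with ht
  have ht0 : 0 < t := by positivity
  set V : Finset (Fin k) → Set (Fin k → X) :=
    fun J => U ∩ {x | t ≤ |w (points (J.restrict x))|} with hV
  -- Almost every point of `U` has an iterated cost of size at least `t`.
  have hcover : ∀ᵐ x ∂powMeasure (Fin k) ν, x ∈ U →
      ∃ J : Finset (Fin k), J.Nonempty ∧ x ∈ V J := by
    filter_upwards [hlower, hη.ae_integrable_addPoints hf hL k] with x hx hint hxU
    have h1 := hx hxU
    rw [integral_sub (hint I₁) (hint I₂)] at h1
    simp only [Configuration.addPoints_eq] at h1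
    obtain ⟨J, hJ, hJt⟩ := exists_le_abs_iterCost I₁ I₂ x (meanAdd P η f) hc h1
    refine ⟨J, hJ, hxU, ?_⟩
    simpa only [Set.mem_ofPred_eq, points_restrict] using hJt
  obtain ⟨J, hJ, hVJ⟩ := exists_le_measure_of_cover (powMeasure (Fin k) ν) hk V hcover
  have hwJ : Measurable fun y : J → X => w (points y) :=
    measurable_iterCost_meanAdd_fintype hη.measurable hf
  have hVm : MeasurableSet (V J) :=
    hU.inter (measurableSet_le measurable_const (hwJ.comp (Finset.measurable_restrict J)).abs)
  have hmin : minProjection ν k U ≤ powMeasure J ν {y | t ≤ |w (points y)|} := by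
    refine (iInf₂_le_of_le J hJ (iInf₂_le_of_le (V J) hVm
      (iInf₂_le_of_le Set.inter_subset_left hVJ le_rfl))).trans (measure_mono ?_)
    rintro _ ⟨x, hx, rfl⟩
    exact hx.2
  have : Nonempty J := hJ.to_subtype
  refine le_trans ?_ (hη.mul_powMeasure_le_variance hf hL (ι := J) ht0)
  refine mul_le_mul' (ENNReal.ofReal_le_ofReal ?_) hmin
  have hcard : Fintype.card J ≤ k := by
    simpa using J.card_le_univ
  have hfac : ((Fintype.card J)! : ℝ) ≤ k ! := by exact_mod_cast Nat.factorial_le hcard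
  have hpow : (2 ^ (k + 1) : ℝ) ^ 2 = 4 ^ (k + 1) := by
    rw [← pow_mul, mul_comm, pow_mul]
    norm_num
  rw [ht, div_pow, hpow, div_div]
  gcongr
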